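/- Let $n\ge 2$ be an integer and let $\lambda>\frac{n-1}{4}$. There is a constant $c(n,\lambda)>0$, depending only on $n$ and $\lambda$, such that the following holds. Let $J\colon[0,\infty)\to[0,\infty)$ be smooth with $J(0)=0$, $J'(0)=1$ and $J(r)>0$ for $r>0$, and endow $\mathbb{R}^n$ with the rotationally symmetric metric $$g=(dr)^2+J(r)^2(d\theta)^2,$$ where $r=|x|$, $\theta=x/|x|$ and $(d\theta)^2$ is the round metric of the unit sphere $\mathbb{S}^{n-1}$ (at the origin, $g$ is the Euclidean inner product). Let $\rho(x)$ be the lowest eigenvalue, with respect to $g$, of the Ricci tensor of $g$ at $x\neq 0$. If the Schrödinger operator $\Delta+\lambda\rho$ (with $\Delta$ the nonnegative Laplacian of $g$) is nonnegative, that is, if $$0\le\int_{\mathbb{R}^n}\left(|d\varphi|_g^2+\lambda\rho\,\varphi^2\right)dv_g\qquad\text{for all }\varphi\in C_0^\infty(\mathbb{R}^n),$$ then for every $R>0$ the geodesic ball of $g$ satisfies $$\operatorname{vol}_g B(0,R)\le c(n,\lambda)\,R^n .$$ -/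

import Mathlib

open MeasureTheory Matrix Set
open scoped ENNReal ContDiff

noncomputable section

namespace RotSym

/-- Euclidean space `ℝⁿ`, the underlying manifold (one global chart). -/
abbrev E (n : ℕ) : Type := EuclideanSpace ℝ (Fin n)

/-- A field of `n × n` matrices on `ℝⁿ`: the components `g_{ij}` of a metric in the global chart. -/
abbrev MetricField (n : ℕ) : Type := E n → Matrix (Fin n) (Fin n) ℝ

/-- The partial derivative `∂_i f (x)`. -/
def partialDeriv {n : ℕ} (f : E n → ℝ) (i : Fin n) (x : E n) : ℝ :=
  fderiv ℝ f x (EuclideanSpace.single i 1)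

/-- Christoffel symbols `Γ^k_{ij} = ½ ∑_l g^{kl} (∂_i g_{jl} + ∂_j g_{il} - ∂_l g_{ij})`. -/
def christoffel {n : ℕ} (g : MetricField n) (k i j : Fin n) (x : E n) : ℝ :=
  (1 / 2 : ℝ) * ∑ l, (g x)⁻¹ k l *
    (partialDeriv (fun y => g y j l) i x + partialDeriv (fun y => g y i l) j x
      - partialDeriv (fun y => g y i j) l x)

/-- Ricci tensor
`Ric_{jk} = ∑_i (∂_i Γ^i_{jk} - ∂_j Γ^i_{ik}) + ∑_{i,m} (Γ^i_{im} Γ^m_{jk} - Γ^i_{jm} Γ^m_{ik})`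
(nonnegative on round spheres). -/
def ricci {n : ℕ} (g : MetricField n) (x : E n) : Matrix (Fin n) (Fin n) ℝ :=
  Matrix.of fun j k => ∑ i,
    (partialDeriv (christoffel g i j k) i x - partialDeriv (christoffel g i i k) j x
      + ∑ m, (christoffel g i i m x * christoffel g m j k x
          - christoffel g i j m x * christoffel g m i k x))

/-- `ρ(x)`: the lowest eigenvalue of the Ricci tensor at `x` with respect to the metric, that is
the least `μ` such that `Ric v = μ g v` for some `v ≠ 0`. -/
def lowestRicci {n : ℕ} (g : MetricField n) (x : E n) : ℝ :=
  sInf {μ : ℝ | ∃ v : Fin n → ℝ, v ≠ 0 ∧ ricci g x *ᵥ v = μ • (g x *ᵥ v)}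

/-- The Riemannian volume measure `√(det g) dx`. -/
def vol {n : ℕ} (g : MetricField n) : Measure (E n) :=
  (volume : Measure (E n)).withDensity fun x => ENNReal.ofReal (Real.sqrt (g x).det)

/-- `|dφ|²_g = ∑_{i,j} g^{ij} ∂_i φ ∂_j φ`. -/
def normSqDiff {n : ℕ} (g : MetricField n) (φ : E n → ℝ) (x : E n) : ℝ :=
  ∑ i, ∑ j, (g x)⁻¹ i j * partialDeriv φ i x * partialDeriv φ j x

/-- Nonnegativity of the Schrödinger operator `Δ + V`, where `Δ` is the nonnegative Laplacian:
`0 ≤ ∫ (|dφ|² + V φ²) dv` for all smooth compactly supported `φ`. -/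
def SchrodingerNonneg {n : ℕ} (g : MetricField n) (V : E n → ℝ) : Prop :=
  ∀ φ : E n → ℝ, ContDiff ℝ ∞ φ → HasCompactSupport φ →
    0 ≤ ∫ x, (normSqDiff g φ x + V x * φ x ^ 2) ∂(vol g)

/-- Length `∫₀¹ √(g(γ', γ')) dt` of a curve `γ : [0,1] → ℝⁿ`. -/
def curveLength {n : ℕ} (g : MetricField n) (γ : ℝ → E n) : ℝ≥0∞ :=
  ∫⁻ t in Icc (0 : ℝ) 1, ENNReal.ofReal (Real.sqrt
    (∑ i, ∑ j, g (γ t) i j * derivWithin γ (Icc 0 1) t i * derivWithin γ (Icc 0 1) t j))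

/-- Riemannian distance: the infimum of the lengths of the `C¹` curves from `x` to `y`. -/
def riemDist {n : ℕ} (g : MetricField n) (x y : E n) : ℝ≥0∞ :=
  ⨅ (γ : ℝ → E n) (_ : ContDiffOn ℝ 1 γ (Icc 0 1)) (_ : γ 0 = x) (_ : γ 1 = y), curveLength g γ

/-- The open geodesic ball `B(x, R)`. -/
def geodBall {n : ℕ} (g : MetricField n) (x : E n) (R : ℝ) : Set (E n) :=
  {y | riemDist g x y < ENNReal.ofReal R}

/-- The metric `dr² + J(r)² dθ²` on `ℝⁿ` in Cartesian coordinates. With `r = ‖x‖` one has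
`dr = ∑ (x_i / r) dx_i`, and the pull-back `dθ²` of the round metric of the unit sphere by
`x ↦ x / r` has components `(δ_{ij} - x_i x_j / r²) / r²`. At the origin the metric is Euclidean,
which is its limit when `J(0) = 0` and `J'(0) = 1`. -/
def rotMetric (n : ℕ) (J : ℝ → ℝ) : MetricField n := fun x =>
  open Classical in
  if x = 0 then 1 else
    Matrix.of fun i j =>
      (x i / ‖x‖) * (x j / ‖x‖)
        + J ‖x‖ ^ 2 * (((if i = j then 1 else 0) - x i * x j / ‖x‖ ^ 2) / ‖x‖ ^ 2)

end RotSym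

end

/-! Write n = m + 2. At x ≠ 0 the Ricci tensor of dr² + J² dθ² has one radial and one tangential
eigenvalue, and ρ is the smaller (`lowestRicci_rotMetric`). Since λ ≥ 0, nonnegativity survives when
ρ is replaced by the tangential eigenvalue. Its product with the density J^(m+1) is -(J' J^m)' + m
J^(m-1), so one integration by parts removes J''. Radial test functions h(r) therefore give 0 ≤ ∫
(J^(m+1) h'² + 2λ J' J^m h h' + λ m J^(m-1) h²) dr + λ 0^m h(0)², where the last term is a boundary
term at the origin, present only for n = 2 (`IsWarping.radial_nonneg`,
`IsWarping.integral_tangential`).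

Take h = (1 - r/L)^(M+1). As J' J^m is the derivative of J^(m+1)/(m+1), a second integration by
parts turns the cross term into -λ/(m+1) ∫ J^(m+1) (h²)''. The weighted volume S = ∫ J^(m+1) (1 -
r/L)^(2M) then carries the factor L⁻² ((M+1)² - 2λ(M+1)(2M+1)/(m+1)), which is negative for large M
because λ > (n-1)/4 (`exists_exponent`). Hence S is controlled by L² times the lower power J^(m-1),
up to the boundary term (`IsWarping.weighted_estimate`). A Young-type inequality absorbs that power
into S, and L = 2R removes the weight on [0, R] (`IsWarping.integral_pow_le`).

This h is neither constant near 0 nor zero beyond L, so `IsWarping.radialEnergy_nonneg_of_smooth`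
reaches it by approximation. For the volume, geodesic balls lie in coordinate balls because radial
distance never exceeds length (`geodBall_subset_ball`). -/

namespace RotSym

/-! ### Partial derivatives of radial functions and coordinates. -/

section PartialDeriv
variable {n : ℕ} {f g : E n → ℝ} {x : E n}

lemma partialDeriv_congr (h : f =ᶠ[nhds x] g) (i : Fin n) :
    partialDeriv f i x = partialDeriv g i x := by
  unfold partialDeriv; rw [h.fderiv_eq]

lemma partialDeriv_add (hf : DifferentiableAt ℝ f x) (hg : DifferentiableAt ℝ g x) (i : Fin n) :
    partialDeriv (fun y => f y + g y) i x = partialDeriv f i x + partialDeriv g i x := by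
  unfold partialDeriv; rw [fderiv_fun_add hf hg]; rfl

lemma partialDeriv_mul (hf : DifferentiableAt ℝ f x) (hg : DifferentiableAt ℝ g x) (i : Fin n) :
    partialDeriv (fun y => f y * g y) i x = f x * partialDeriv g i x + partialDeriv f i x * g x := by
  unfold partialDeriv; rw [fderiv_fun_mul hf hg]
  simp [mul_comm]

lemma partialDeriv_const (c : ℝ) (i : Fin n) : partialDeriv (fun _ : E n => c) i x = 0 := by
  simp [partialDeriv]

lemma differentiableAt_coord (j : Fin n) : DifferentiableAt ℝ (fun y : E n => y j) x :=
  (EuclideanSpace.proj (𝕜 := ℝ) j).differentiableAt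

lemma partialDeriv_coord (i j : Fin n) :
    partialDeriv (fun y : E n => y j) i x = if i = j then 1 else 0 := by
  unfold partialDeriv
  have : fderiv ℝ (fun y : E n => y j) x = EuclideanSpace.proj (𝕜 := ℝ) j :=
    (EuclideanSpace.proj (𝕜 := ℝ) j).fderiv
  rw [this]
  simp [eq_comm]

lemma hasFDerivAt_norm (hx : x ≠ 0) :
    HasFDerivAt (fun y : E n => ‖y‖) (‖x‖⁻¹ • innerSL ℝ x) x := by
  have h1 : HasFDerivAt (fun y : E n => ‖y‖ ^ 2) (2 • innerSL ℝ x) x :=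
    (hasStrictFDerivAt_norm_sq x).hasFDerivAt
  have h2 := h1.sqrt (by simpa using hx)
  have hn : ‖x‖ ≠ 0 := by simpa using hx
  simp only [Real.sqrt_sq (norm_nonneg _)] at h2
  have h3 : (1 / (2 * ‖x‖)) • 2 • innerSL ℝ x = ‖x‖⁻¹ • innerSL ℝ x := by
    rw [two_smul, ← two_smul ℝ, smul_smul]
    congr 1
    field_simp
  rwa [h3] at h2

lemma hasFDerivAt_radial {F : ℝ → ℝ} {F' : ℝ} (hF : HasDerivAt F F' ‖x‖) (hx : x ≠ 0) :
    HasFDerivAt (fun y : E n => F ‖y‖) (F' • (‖x‖⁻¹ • innerSL ℝ x)) x :=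
  hF.comp_hasFDerivAt x (hasFDerivAt_norm hx)

lemma partialDeriv_radial {F : ℝ → ℝ} {F' : ℝ} (hF : HasDerivAt F F' ‖x‖) (hx : x ≠ 0)
    (i : Fin n) : partialDeriv (fun y : E n => F ‖y‖) i x = F' / ‖x‖ * x i := by
  unfold partialDeriv
  rw [(hasFDerivAt_radial hF hx).fderiv]
  simp [EuclideanSpace.inner_single_right]
  ring

lemma partialDeriv_radial_mul {F : ℝ → ℝ} {F' : ℝ} (hF : HasDerivAt F F' ‖x‖) (hx : x ≠ 0)
    (hg : DifferentiableAt ℝ g x) (i : Fin n) :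
    partialDeriv (fun y : E n => F ‖y‖ * g y) i x
      = F ‖x‖ * partialDeriv g i x + F' / ‖x‖ * x i * g x := by
  rw [partialDeriv_mul (hasFDerivAt_radial hF hx).differentiableAt hg, partialDeriv_radial hF hx]

end PartialDeriv

/-! ### Algebra of matrices a δ + b x ⊗ x, and the metric as one of them. -/

section Metric
variable {n : ℕ}

lemma sum_sq_eq_norm_sq (x : E n) : ∑ i, x i * x i = ‖x‖ ^ 2 := by
  rw [EuclideanSpace.norm_sq_eq]
  simp [sq]

/-- The matrix `a δ_{ij} + b x_i x_j`. -/
def isoMatrix (a b : ℝ) (x : E n) : Matrix (Fin n) (Fin n) ℝ :=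
  Matrix.of fun i j => a * (if i = j then 1 else 0) + b * (x i * x j)

lemma isoMatrix_mul (a b c d : ℝ) (x : E n) :
    isoMatrix a b x * isoMatrix c d x
      = isoMatrix (a * c) (a * d + b * c + b * d * ‖x‖ ^ 2) x := by
  ext i j
  have h : ∀ k, isoMatrix a b x i k * isoMatrix c d x k j
      = (if i = k then a * isoMatrix c d x k j else 0)
        + (if k = j then b * c * (x i * x k) else 0) + b * d * x i * x j * (x k * x k) := by
    intro k
    simp only [isoMatrix, Matrix.of_apply]
    split_ifs <;> ring
  rw [Matrix.mul_apply, Finset.sum_congr rfl fun k _ => h k, Finset.sum_add_distrib,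
    Finset.sum_add_distrib, ← Finset.mul_sum, sum_sq_eq_norm_sq]
  simp [isoMatrix]
  split_ifs <;> ring

lemma isoMatrix_mulVec (a b : ℝ) (x : E n) (v : Fin n → ℝ) :
    isoMatrix a b x *ᵥ v = fun i => a * v i + b * (∑ j, x j * v j) * x i := by
  ext i
  have h : ∀ k, isoMatrix a b x i k * v k
      = (if i = k then a * v k else 0) + b * x i * (x k * v k) := by
    intro k
    simp only [isoMatrix, Matrix.of_apply]
    split_ifs <;> ring
  rw [Matrix.mulVec, dotProduct, Finset.sum_congr rfl fun k _ => h k, Finset.sum_add_distrib,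
    ← Finset.mul_sum]
  simp
  ring

/-- The condition `hab` makes x an eigenvector of eigenvalue 1 (the radial direction has unit
length), while a is the eigenvalue on the orthogonal complement of x. Inversion keeps the 1 and
inverts a. -/
lemma isoMatrix_inv {a b : ℝ} {x : E n} (hx : x ≠ 0) (ha : a ≠ 0) (hab : a + b * ‖x‖ ^ 2 = 1) :
    (isoMatrix a b x)⁻¹ = isoMatrix a⁻¹ ((1 - a⁻¹) / ‖x‖ ^ 2) x := by
  have hn : ‖x‖ ≠ 0 := by simpa using hx
  apply Matrix.inv_eq_right_inv
  rw [isoMatrix_mul]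
  have : a * ((1 - a⁻¹) / ‖x‖ ^ 2) + b * a⁻¹ + b * ((1 - a⁻¹) / ‖x‖ ^ 2) * ‖x‖ ^ 2 = 0 := by
    have hb : b = (1 - a) / ‖x‖ ^ 2 := by field_simp; linarith
    rw [hb]; field_simp; ring
  rw [this, mul_inv_cancel₀ ha]
  ext i j
  simp [isoMatrix, Matrix.one_apply]

lemma isoMatrix_det {a b : ℝ} {x : E n} (hn : 1 ≤ n) (ha : a ≠ 0) (hab : a + b * ‖x‖ ^ 2 = 1) :
    (isoMatrix a b x).det = a ^ (n - 1) := by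
  have h : isoMatrix a b x = a • (1 + Matrix.replicateCol Unit (fun i => b / a * x i)
      * Matrix.replicateRow Unit (fun i => x i)) := by
    ext i j
    simp [isoMatrix, Matrix.one_apply, Matrix.mul_apply]
    split_ifs <;> field_simp <;> ring
  rw [h, Matrix.det_smul, Matrix.det_one_add_replicateCol_mul_replicateRow]
  have h2 : (fun i => x i) ⬝ᵥ (fun i => b / a * x i) = b / a * ‖x‖ ^ 2 := by
    rw [← sum_sq_eq_norm_sq, Finset.mul_sum, dotProduct]
    exact Finset.sum_congr rfl fun i _ => by ring
  rw [h2]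
  obtain ⟨m, rfl⟩ : ∃ m, n = m + 1 := ⟨n - 1, by omega⟩
  simp only [Fintype.card_fin, Nat.add_sub_cancel]
  have : 1 + b / a * ‖x‖ ^ 2 = a⁻¹ := by field_simp; linarith
  rw [this, pow_succ]
  field_simp

lemma rotMetric_eq (J : ℝ → ℝ) {x : E n} (hx : x ≠ 0) :
    rotMetric n J x
      = isoMatrix (J ‖x‖ ^ 2 / ‖x‖ ^ 2) ((1 - J ‖x‖ ^ 2 / ‖x‖ ^ 2) / ‖x‖ ^ 2) x := by
  have hn : ‖x‖ ≠ 0 := by simpa using hx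
  ext i j
  simp only [rotMetric, if_neg hx, isoMatrix, Matrix.of_apply]
  split_ifs <;> field_simp <;> ring

lemma rotMetric_coeff (s : ℝ) {x : E n} (hx : x ≠ 0) :
    s + (1 - s) / ‖x‖ ^ 2 * ‖x‖ ^ 2 = 1 := by
  have hn : ‖x‖ ≠ 0 := by simpa using hx
  field_simp; ring

lemma rotMetric_inv {J : ℝ → ℝ} {x : E n} (hx : x ≠ 0) (hJ : 0 < J ‖x‖) :
    (rotMetric n J x)⁻¹ = isoMatrix (J ‖x‖ ^ 2 / ‖x‖ ^ 2)⁻¹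
      ((1 - (J ‖x‖ ^ 2 / ‖x‖ ^ 2)⁻¹) / ‖x‖ ^ 2) x := by
  have hn : 0 < ‖x‖ := by simpa using hx
  rw [rotMetric_eq J hx, isoMatrix_inv hx (by positivity) (rotMetric_coeff _ hx)]

lemma sqrt_det_rotMetric {J : ℝ → ℝ} {x : E n} (h1 : 1 ≤ n) (hx : x ≠ 0) (hJ : 0 < J ‖x‖) :
    Real.sqrt (rotMetric n J x).det = (J ‖x‖ / ‖x‖) ^ (n - 1) := by
  have hn : 0 < ‖x‖ := by simpa using hx
  rw [rotMetric_eq J hx, isoMatrix_det h1 (by positivity) (rotMetric_coeff _ hx), ← div_pow,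
    ← pow_mul, mul_comm, pow_mul, Real.sqrt_sq (by positivity)]

/-- The differential is h' dr, and dr is a unit covector because the inverse metric also has radial
eigenvalue 1. -/
lemma normSqDiff_radial {J h : ℝ → ℝ} {h' : ℝ} {x : E n} (hx : x ≠ 0) (hJ : 0 < J ‖x‖)
    (hh : HasDerivAt h h' ‖x‖) :
    normSqDiff (rotMetric n J) (fun y => h ‖y‖) x = h' ^ 2 := by
  have hn : 0 < ‖x‖ := by simpa using hx
  have key : normSqDiff (rotMetric n J) (fun y => h ‖y‖) x
      = ∑ i, h' / ‖x‖ * x i * ((rotMetric n J x)⁻¹ *ᵥ (fun j => h' / ‖x‖ * x j)) i := by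
    unfold normSqDiff
    refine Finset.sum_congr rfl fun i _ => ?_
    rw [Matrix.mulVec, dotProduct, Finset.mul_sum]
    refine Finset.sum_congr rfl fun j _ => ?_
    rw [partialDeriv_radial hh hx, partialDeriv_radial hh hx]
    ring
  rw [key, rotMetric_inv hx hJ, isoMatrix_mulVec]
  set d := (1 - (J ‖x‖ ^ 2 / ‖x‖ ^ 2)⁻¹) / ‖x‖ ^ 2 with hd
  have e1 : ∑ j, x j * (h' / ‖x‖ * x j) = h' / ‖x‖ * ‖x‖ ^ 2 := by
    rw [← sum_sq_eq_norm_sq, Finset.mul_sum]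
    exact Finset.sum_congr rfl fun i _ => by ring
  simp only [e1]
  have e2 : ∀ i, h' / ‖x‖ * x i * ((J ‖x‖ ^ 2 / ‖x‖ ^ 2)⁻¹ * (h' / ‖x‖ * x i)
      + d * (h' / ‖x‖ * ‖x‖ ^ 2) * x i)
      = (h' / ‖x‖) ^ 2 * ((J ‖x‖ ^ 2 / ‖x‖ ^ 2)⁻¹ + d * ‖x‖ ^ 2) * (x i * x i) := fun i => by ring
  rw [Finset.sum_congr rfl fun i _ => e2 i, ← Finset.mul_sum, sum_sq_eq_norm_sq,
    rotMetric_coeff _ hx]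
  field_simp

end Metric

/-! ### Christoffel symbols and Ricci tensor of dr² + J² dθ². -/

section Curvature
variable {n : ℕ}

lemma partialDeriv_isoMatrix {A B : ℝ → ℝ} {A' B' : ℝ} {x : E n} (hx : x ≠ 0)
    (hA : HasDerivAt A A' ‖x‖) (hB : HasDerivAt B B' ‖x‖) (i j l : Fin n) :
    partialDeriv (fun y => isoMatrix (A ‖y‖) (B ‖y‖) y j l) i x
      = A' / ‖x‖ * x i * (if j = l then 1 else 0) + B' / ‖x‖ * x i * (x j * x l)
        + B ‖x‖ * ((if i = l then 1 else 0) * x j + (if i = j then 1 else 0) * x l) := by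
  have hd : DifferentiableAt ℝ (fun y : E n => y j * y l) x :=
    (differentiableAt_coord j).mul (differentiableAt_coord l)
  simp only [isoMatrix, Matrix.of_apply]
  rw [partialDeriv_add, partialDeriv_radial_mul hA hx (differentiableAt_const _),
    partialDeriv_radial_mul hB hx hd, partialDeriv_const,
    partialDeriv_mul (differentiableAt_coord j) (differentiableAt_coord l), partialDeriv_coord,
    partialDeriv_coord]
  · ring
  · exact (hasFDerivAt_radial hA hx).differentiableAt.mul (differentiableAt_const _)
  · exact (hasFDerivAt_radial hB hx).differentiableAt.mul hd

/-- The three-tensor `p (x_i δ_{jk} + x_j δ_{ik}) + q δ_{ij} x_k + w x_i x_j x_k`. -/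
noncomputable def isoTensor (p q w : ℝ) (x : E n) (k i j : Fin n) : ℝ :=
  p * (x i * (if j = k then 1 else 0) + x j * (if i = k then 1 else 0))
    + q * ((if i = j then 1 else 0) * x k) + w * (x i * x j * x k)

/-- Coefficient of `x_i δ_{jk} + x_j δ_{ik}` in the Christoffel symbols of `dr² + J² dθ²`. -/
noncomputable def chrisP (J J1 : ℝ → ℝ) (r : ℝ) : ℝ := (J1 r / J r - 1 / r) / r

/-- Coefficient of `δ_{ij} x_k` in the Christoffel symbols of `dr² + J² dθ²`. -/
noncomputable def chrisQ (J J1 : ℝ → ℝ) (r : ℝ) : ℝ := (1 - J r * J1 r / r) / r ^ 2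

/-- Coefficient of `x_i x_j x_k` in the Christoffel symbols of `dr² + J² dθ²`. -/
noncomputable def chrisW (J J1 : ℝ → ℝ) (r : ℝ) : ℝ := -(2 * chrisP J J1 r + chrisQ J J1 r) / r ^ 2

lemma sum_isoMatrix_mul (a b : ℝ) (x : E n) (k i j : Fin n) (c1 c2 c3 : ℝ) :
    ∑ l, isoMatrix a b x k l * (c1 * (if j = l then 1 else 0) + c2 * (if i = l then 1 else 0)
        + c3 * x l)
      = a * (c1 * (if j = k then 1 else 0) + c2 * (if i = k then 1 else 0) + c3 * x k)
        + b * (c1 * x j + c2 * x i + c3 * ‖x‖ ^ 2) * x k := by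
  have := congrFun (isoMatrix_mulVec a b x (fun l => c1 * (if j = l then 1 else 0)
    + c2 * (if i = l then 1 else 0) + c3 * x l)) k
  rw [Matrix.mulVec, dotProduct] at this
  rw [this]
  have h : ∑ l, x l * (c1 * (if j = l then 1 else 0) + c2 * (if i = l then 1 else 0) + c3 * x l)
      = c1 * x j + c2 * x i + c3 * ‖x‖ ^ 2 := by
    rw [← sum_sq_eq_norm_sq, Finset.mul_sum]
    simp only [mul_add, Finset.sum_add_distrib]
    congr 1
    · simp [mul_comm]
    · exact Finset.sum_congr rfl fun i _ => by ring
  rw [h]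

variable {J J1 J2 : ℝ → ℝ}

/-- Rotational symmetry leaves only tensors built from δ and x with radial coefficients. The cubic
coefficient is fixed by the other two, since rays are geodesics: Γ(x, x) = 0 means 2p + q + w r² =
0. -/
lemma christoffel_rotMetric (hJ : ∀ r, 0 < r → HasDerivAt J (J1 r) r) (hpos : ∀ r, 0 < r → 0 < J r)
    {x : E n} (hx : x ≠ 0) (k i j : Fin n) :
    christoffel (rotMetric n J) k i j x
      = isoTensor (chrisP J J1 ‖x‖) (chrisQ J J1 ‖x‖) (chrisW J J1 ‖x‖) x k i j := by
  have hr : 0 < ‖x‖ := by simpa using hx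
  have hJp := hpos _ hr
  set r := ‖x‖ with hrdef
  set a := J r ^ 2 / r ^ 2 with ha
  set a' := (2 * J r * J1 r * r ^ 2 - J r ^ 2 * (2 * r)) / (r ^ 2) ^ 2 with ha'
  set b := (1 - a) / r ^ 2 with hb
  set b' := (-a' * r ^ 2 - (1 - a) * (2 * r)) / (r ^ 2) ^ 2 with hb'
  have hA : HasDerivAt (fun s => J s ^ 2 / s ^ 2) a' r := by
    exact (((hJ r hr).fun_pow 2).fun_div ((hasDerivAt_id' r).fun_pow 2)
      (pow_ne_zero 2 hr.ne')).congr_deriv (by simp [ha'])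
  have hB : HasDerivAt (fun s => (1 - J s ^ 2 / s ^ 2) / s ^ 2) b' r := by
    exact ((hA.const_sub 1).fun_div ((hasDerivAt_id' r).fun_pow 2)
      (pow_ne_zero 2 hr.ne')).congr_deriv (by simp [hb', ha])
  have hpd : ∀ i j l, partialDeriv (fun y => rotMetric n J y j l) i x
      = a' / r * x i * (if j = l then 1 else 0) + b' / r * x i * (x j * x l)
        + b * ((if i = l then 1 else 0) * x j + (if i = j then 1 else 0) * x l) := by
    intro i j l
    rw [← partialDeriv_isoMatrix hx hA hB i j l]
    refine partialDeriv_congr ?_ i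
    filter_upwards [isOpen_ne.mem_nhds hx] with y hy
    rw [rotMetric_eq J hy]
  unfold christoffel
  rw [rotMetric_inv hx hJp]
  simp only [hpd]
  rw [← hrdef, ← ha]
  set δ := (if i = j then 1 else 0 : ℝ) with hδ
  have hδ2 : (if j = i then 1 else 0 : ℝ) = δ := by simp [hδ, eq_comm]
  have e : ∀ l, (a' / r * x i * (if j = l then 1 else 0) + b' / r * x i * (x j * x l)
          + b * ((if i = l then 1 else 0) * x j + δ * x l)
        + (a' / r * x j * (if i = l then 1 else 0) + b' / r * x j * (x i * x l)
          + b * ((if j = l then 1 else 0) * x i + (if j = i then 1 else 0) * x l))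
        - (a' / r * x l * δ + b' / r * x l * (x i * x j)
          + b * ((if l = j then 1 else 0) * x i + (if l = i then 1 else 0) * x j)))
      = a' / r * x i * (if j = l then 1 else 0) + a' / r * x j * (if i = l then 1 else 0)
        + (b' / r * x i * x j + (2 * b - a' / r) * δ) * x l := by
    intro l
    rw [hδ2]
    simp only [eq_comm (a := l)]
    ring
  rw [Finset.sum_congr rfl fun l _ => by rw [e l], sum_isoMatrix_mul,
    ← hrdef]
  simp only [isoTensor, ← hδ]
  have hp : chrisP J J1 r = a' / r / (2 * a) := by
    rw [chrisP, ha', ha]; field_simp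
  have hq : chrisQ J J1 r = b - a' / r / 2 := by
    rw [chrisQ, hb, ha', ha]; field_simp; ring
  have hw : chrisW J J1 r = a⁻¹ * (b' / r / 2) + (1 - a⁻¹) / r ^ 2 * (a' / r)
      + (1 - a⁻¹) / r ^ 2 * (b' / r / 2 * r ^ 2) := by
    rw [chrisW, hp, hq, hb', hb, ha', ha]; field_simp; ring
  -- The first factor equals 1; it is left in the shape that contraction with the inverse metric
  -- produces.
  have hq2 : chrisQ J J1 r = (a⁻¹ + (1 - a⁻¹) / r ^ 2 * r ^ 2) * (2 * b - a' / r) / 2 := by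
    rw [hq]; field_simp; ring
  rw [hw, hq2, hp]
  field_simp
  ring

lemma partialDeriv_isoTensor {P Q W : ℝ → ℝ} {P' Q' W' : ℝ} {x : E n} (hx : x ≠ 0)
    (hP : HasDerivAt P P' ‖x‖) (hQ : HasDerivAt Q Q' ‖x‖) (hW : HasDerivAt W W' ‖x‖)
    (l k i j : Fin n) :
    partialDeriv (fun y => isoTensor (P ‖y‖) (Q ‖y‖) (W ‖y‖) y k i j) l x
      = P' / ‖x‖ * x l * (x i * (if j = k then 1 else 0) + x j * (if i = k then 1 else 0))
        + P ‖x‖ * ((if l = i then 1 else 0) * (if j = k then 1 else 0)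
          + (if l = j then 1 else 0) * (if i = k then 1 else 0))
        + Q' / ‖x‖ * x l * ((if i = j then 1 else 0) * x k)
        + Q ‖x‖ * ((if i = j then 1 else 0) * (if l = k then 1 else 0))
        + W' / ‖x‖ * x l * (x i * x j * x k)
        + W ‖x‖ * ((if l = i then 1 else 0) * x j * x k + (if l = j then 1 else 0) * x i * x k
          + (if l = k then 1 else 0) * x i * x j) := by
  have hc : ∀ m : Fin n, DifferentiableAt ℝ (fun y : E n => y m) x := differentiableAt_coord
  have hk : ∀ c : ℝ, DifferentiableAt ℝ (fun _ : E n => c) x := fun c => differentiableAt_const c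
  have dP := (hasFDerivAt_radial hP hx).differentiableAt
  have dQ := (hasFDerivAt_radial hQ hx).differentiableAt
  have dW := (hasFDerivAt_radial hW hx).differentiableAt
  have d1 := ((hc i).fun_mul (hk (if j = k then 1 else 0))).fun_add ((hc j).fun_mul (hk (if i = k then 1 else 0)))
  have d2 := (hk (if i = j then 1 else 0)).fun_mul (hc k)
  have d3 := ((hc i).fun_mul (hc j)).fun_mul (hc k)
  simp only [isoTensor]
  rw [partialDeriv_add ((dP.fun_mul d1).fun_add (dQ.fun_mul d2)) (dW.fun_mul d3),
    partialDeriv_add (dP.fun_mul d1) (dQ.fun_mul d2),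
    partialDeriv_radial_mul hP hx d1, partialDeriv_radial_mul hQ hx d2,
    partialDeriv_radial_mul hW hx d3,
    partialDeriv_add ((hc i).fun_mul (hk _)) ((hc j).fun_mul (hk _)),
    partialDeriv_mul (hc i) (hk _), partialDeriv_mul (hc j) (hk _),
    partialDeriv_mul (hk _) (hc k), partialDeriv_mul ((hc i).fun_mul (hc j)) (hc k),
    partialDeriv_mul (hc i) (hc j)]
  simp only [partialDeriv_const, partialDeriv_coord]
  ring

section Contractions
variable (x : E n) (p q w p' q' w' : ℝ)

lemma sum_isoTensor_trace (m : Fin n) :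
    ∑ i, isoTensor p q w x i i m = ((n + 1) * p + q + w * ‖x‖ ^ 2) * x m := by
  have h : ∀ i, isoTensor p q w x i i m = (p + q) * ((if m = i then 1 else 0) * x i) + p * x m
      + w * x m * (x i * x i) := by
    intro i
    simp only [isoTensor, eq_comm (a := i), if_true]
    ring
  simp only [h, Finset.sum_add_distrib, ← Finset.mul_sum, sum_sq_eq_norm_sq]
  simp
  ring

lemma sum_coord_mul_isoTensor (j k : Fin n) :
    ∑ m, x m * isoTensor p q w x m j k
      = q * ‖x‖ ^ 2 * (if j = k then 1 else 0) + (2 * p + w * ‖x‖ ^ 2) * (x j * x k) := by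
  have h : ∀ m, x m * isoTensor p q w x m j k = p * x j * ((if k = m then 1 else 0) * x m)
      + p * x k * ((if j = m then 1 else 0) * x m)
      + (q * (if j = k then 1 else 0) + w * (x j * x k)) * (x m * x m) := by
    intro m
    simp only [isoTensor]
    ring
  simp only [h, Finset.sum_add_distrib, ← Finset.mul_sum, sum_sq_eq_norm_sq]
  simp
  split_ifs <;> ring

lemma sum_isoTensor_mul_isoTensor_trace (j k : Fin n) :
    ∑ i, ∑ m, isoTensor p q w x i i m * isoTensor p q w x m j k
      = ((n + 1) * p + q + w * ‖x‖ ^ 2) * (q * ‖x‖ ^ 2 * (if j = k then 1 else 0)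
        + (2 * p + w * ‖x‖ ^ 2) * (x j * x k)) := by
  rw [Finset.sum_comm]
  simp only [← Finset.sum_mul, sum_isoTensor_trace]
  rw [← sum_coord_mul_isoTensor, Finset.mul_sum]
  exact Finset.sum_congr rfl fun m _ => by ring

/-- For fixed outer indices, each factor of the quadratic Christoffel term is a combination of x_m
and two Kronecker deltas. Abstract coefficients allow the product to be summed once. -/
lemma sum_basis_mul (i j k : Fin n) (c1 c2 c3 d1 d2 d3 : ℝ) :
    ∑ m, (c1 * (if m = i then 1 else 0) + c2 * x m + c3 * (if j = m then 1 else 0))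
        * (d1 * (if k = m then 1 else 0) + d2 * (if i = m then 1 else 0) + d3 * x m)
      = c1 * (d1 * (if k = i then 1 else 0) + d2 + d3 * x i)
        + c2 * (d1 * x k + d2 * x i + d3 * ‖x‖ ^ 2)
        + c3 * (d1 * (if k = j then 1 else 0) + d2 * (if i = j then 1 else 0) + d3 * x j) := by
  simp only [add_mul, Finset.sum_add_distrib, mul_assoc, ← Finset.mul_sum]
  congr 1
  · congr 1
    · simp
    · simp only [mul_add, Finset.sum_add_distrib, ← sum_sq_eq_norm_sq, Finset.mul_sum]
      congr 1
      · simp [mul_comm]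
      · exact Finset.sum_congr rfl fun m _ => by ring
  · simp

lemma sum_isoTensor_mul_isoTensor_swap (j k : Fin n) :
    ∑ i, ∑ m, isoTensor p q w x i j m * isoTensor p q w x m i k
      = 2 * p * q * ‖x‖ ^ 2 * (if j = k then 1 else 0)
        + ((n + 3) * p ^ 2 + 2 * p * q + q ^ 2 + 4 * p * w * ‖x‖ ^ 2 + 2 * q * w * ‖x‖ ^ 2
          + w ^ 2 * ‖x‖ ^ 4) * (x j * x k) := by
  have hin : ∀ i, ∑ m, isoTensor p q w x i j m * isoTensor p q w x m i k
      = p ^ 2 * (x j * x k)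
        + (p ^ 2 + p * q + q ^ 2) * x j * ((if k = i then 1 else 0) * x i)
        + (2 * p ^ 2 + p * q) * x k * ((if j = i then 1 else 0) * x i)
        + ‖x‖ ^ 2 * p * q * ((if j = i then 1 else 0) * (if k = i then 1 else 0))
        + ‖x‖ ^ 2 * p * w * x k * ((if j = i then 1 else 0) * x i)
        + ‖x‖ ^ 2 * q * w * x j * ((if k = i then 1 else 0) * x i)
        + (3 * p * w * (x j * x k) + ‖x‖ ^ 2 * w ^ 2 * (x j * x k)
          + p * q * (if j = k then 1 else 0) + q * w * (x j * x k)) * (x i * x i) := by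
    intro i
    have e := sum_basis_mul x i j k (p * x j) (p * (if j = i then 1 else 0) + w * x j * x i)
      (q * x i) (p * x i) (p * x k) (q * (if k = i then 1 else 0) + w * x i * x k)
    have e2 : ∑ m, isoTensor p q w x i j m * isoTensor p q w x m i k = _ :=
      (Finset.sum_congr rfl fun m _ => by
        simp only [isoTensor, eq_comm (a := i) (b := k)]; ring).trans e
    rw [e2]
    simp only [eq_comm (a := i) (b := j), eq_comm (a := k) (b := j)]
    ring
  simp only [hin, Finset.sum_add_distrib, ← Finset.mul_sum, sum_sq_eq_norm_sq]
  simp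
  split_ifs <;> ring

end Contractions

/-- Radial Ricci curvature of `dr² + J² dθ²`. -/
noncomputable def radialRicci (n : ℕ) (J J2 : ℝ → ℝ) (r : ℝ) : ℝ := -((n : ℝ) - 1) * J2 r / J r

/-- Tangential Ricci curvature of `dr² + J² dθ²`. -/
noncomputable def tangentialRicci (n : ℕ) (J J1 J2 : ℝ → ℝ) (r : ℝ) : ℝ :=
  -J2 r / J r + ((n : ℝ) - 2) * (1 - J1 r ^ 2) / J r ^ 2

/-- The coefficients are arranged so that, relative to the metric, the eigenvalue is `radialRicci`
along x and `tangentialRicci` orthogonally to x. -/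
lemma ricci_rotMetric (hJ : ∀ r, 0 < r → HasDerivAt J (J1 r) r)
    (hJ1 : ∀ r, 0 < r → HasDerivAt J1 (J2 r) r) (hpos : ∀ r, 0 < r → 0 < J r)
    {x : E n} (hx : x ≠ 0) :
    ricci (rotMetric n J) x
      = isoMatrix (tangentialRicci n J J1 J2 ‖x‖ * (J ‖x‖ ^ 2 / ‖x‖ ^ 2))
        ((radialRicci n J J2 ‖x‖ - tangentialRicci n J J1 J2 ‖x‖ * (J ‖x‖ ^ 2 / ‖x‖ ^ 2))
          / ‖x‖ ^ 2) x := by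
  have hr : 0 < ‖x‖ := by simpa using hx
  have hJp := hpos _ hr
  have hΓ : ∀ k i j, christoffel (rotMetric n J) k i j =ᶠ[nhds x] fun y =>
      isoTensor (chrisP J J1 ‖y‖) (chrisQ J J1 ‖y‖) (chrisW J J1 ‖y‖) y k i j := by
    intro k i j
    filter_upwards [isOpen_ne.mem_nhds hx] with y hy
    exact christoffel_rotMetric hJ hpos hy k i j
  obtain ⟨r, hrdef⟩ : ∃ r, r = ‖x‖ := ⟨_, rfl⟩
  rw [← hrdef] at hr hJp
  set P' := (((J2 r * J r - J1 r * J1 r) / J r ^ 2 + 1 / r ^ 2) * r - (J1 r / J r - 1 / r)) / r ^ 2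
    with hP'
  set Q' := (-(((J1 r * J1 r + J r * J2 r) * r - J r * J1 r) / r ^ 2) * r ^ 2
    - (1 - J r * J1 r / r) * (2 * r)) / (r ^ 2) ^ 2 with hQ'
  set W' := (-(2 * P' + Q') * r ^ 2 + (2 * chrisP J J1 r + chrisQ J J1 r) * (2 * r)) / (r ^ 2) ^ 2
    with hW'
  have hP : HasDerivAt (chrisP J J1) P' r :=
    ((((hJ1 r hr).fun_div (hJ r hr) hJp.ne').fun_sub
      ((hasDerivAt_const r (1 : ℝ)).fun_div (hasDerivAt_id' r) hr.ne')).fun_div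
        (hasDerivAt_id' r) hr.ne').congr_deriv (by rw [hP']; field_simp; ring)
  have hQ : HasDerivAt (chrisQ J J1) Q' r :=
    (((((hJ r hr).fun_mul (hJ1 r hr)).fun_div (hasDerivAt_id' r) hr.ne').const_sub 1).fun_div
      ((hasDerivAt_id' r).fun_pow 2) (pow_ne_zero 2 hr.ne')).congr_deriv (by simp [hQ'])
  have hW : HasDerivAt (chrisW J J1) W' r :=
    ((((hP.const_mul 2).fun_add hQ).fun_neg).fun_div
      ((hasDerivAt_id' r).fun_pow 2) (pow_ne_zero 2 hr.ne')).congr_deriv (by simp [hW']; ring)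
  have hpd := fun l k i j => (partialDeriv_congr (hΓ k i j) l).trans
    (partialDeriv_isoTensor hx (hrdef ▸ hP) (hrdef ▸ hQ) (hrdef ▸ hW) l k i j)
  ext j k
  simp only [ricci, Matrix.of_apply, Finset.sum_add_distrib, Finset.sum_sub_distrib,
    (hΓ _ _ _).eq_of_nhds, sum_isoTensor_mul_isoTensor_trace, sum_isoTensor_mul_isoTensor_swap]
  rw [Finset.sum_congr rfl fun i _ => hpd i i j k, Finset.sum_congr rfl fun i _ => hpd j i i k]
  rw [← hrdef]
  set p := chrisP J J1 r with hp
  set q := chrisQ J J1 r with hq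
  set w := chrisW J J1 r with hw
  have s1 : ∀ i, P' / r * x i * (x j * (if k = i then 1 else 0) + x k * (if j = i then 1 else 0))
        + p * ((if i = j then 1 else 0) * (if k = i then 1 else 0)
          + (if i = k then 1 else 0) * (if j = i then 1 else 0))
        + Q' / r * x i * ((if j = k then 1 else 0) * x i)
        + q * ((if j = k then 1 else 0) * (if i = i then 1 else 0))
        + W' / r * x i * (x j * x k * x i)
        + w * ((if i = j then 1 else 0) * x k * x i + (if i = k then 1 else 0) * x j * x i
          + (if i = i then 1 else 0) * x j * x k)
      = (P' / r + w) * x j * ((if k = i then 1 else 0) * x i)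
        + (P' / r + w) * x k * ((if j = i then 1 else 0) * x i)
        + 2 * p * ((if j = i then 1 else 0) * (if k = i then 1 else 0))
        + (Q' / r * (if j = k then 1 else 0) + W' / r * x j * x k) * (x i * x i)
        + (q * (if j = k then 1 else 0) + w * x j * x k) := by
    intro i
    simp only [eq_comm (a := i), if_true]
    ring
  have s2 : ∀ i, P' / r * x j * (x i * (if k = i then 1 else 0) + x k * (if i = i then 1 else 0))
        + p * ((if j = i then 1 else 0) * (if k = i then 1 else 0)
          + (if j = k then 1 else 0) * (if i = i then 1 else 0))
        + Q' / r * x j * ((if i = k then 1 else 0) * x i)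
        + q * ((if i = k then 1 else 0) * (if j = i then 1 else 0))
        + W' / r * x j * (x i * x k * x i)
        + w * ((if j = i then 1 else 0) * x k * x i + (if j = k then 1 else 0) * x i * x i
          + (if j = i then 1 else 0) * x i * x k)
      = (P' / r + Q' / r) * x j * ((if k = i then 1 else 0) * x i)
        + 2 * w * x k * ((if j = i then 1 else 0) * x i)
        + (p + q) * ((if j = i then 1 else 0) * (if k = i then 1 else 0))
        + (w * (if j = k then 1 else 0) + W' / r * x j * x k) * (x i * x i)
        + (p * (if j = k then 1 else 0) + P' / r * x j * x k) := by
    intro i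
    simp only [eq_comm (a := i), if_true]
    ring
  rw [Finset.sum_congr rfl fun i _ => s1 i, Finset.sum_congr rfl fun i _ => s2 i]
  simp only [Finset.sum_add_distrib, ← Finset.mul_sum, sum_sq_eq_norm_sq, ← hrdef]
  simp only [ite_mul, one_mul, zero_mul, Finset.sum_ite_eq, Finset.mem_univ, if_true,
    Finset.sum_const, Finset.card_univ, Fintype.card_fin, nsmul_eq_mul, isoMatrix, Matrix.of_apply,
    eq_comm (a := k) (b := j)]
  set D := (if j = k then 1 else 0 : ℝ)
  -- Only two scalar identities remain, for the coefficients of δ_jk (`hU`) and of x_j x_k (`hV`);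
  -- both are rational in r, J and its first two derivatives.
  have hU : tangentialRicci n J J1 J2 r * (J r ^ 2 / r ^ 2) = 2 * p + Q' / r * r ^ 2 + n * q
      - ((p + q) + w * r ^ 2 + n * p) + ((n + 1) * p + q + w * r ^ 2) * (q * r ^ 2)
      - 2 * p * q * r ^ 2 := by
    rw [hw, chrisW, ← hp, ← hq, hQ', hp, hq, chrisP, chrisQ, tangentialRicci]
    field_simp
    ring
  have hV : (radialRicci n J J2 r - tangentialRicci n J J1 J2 r * (J r ^ 2 / r ^ 2)) / r ^ 2
      = 2 * (P' / r + w) + W' / r * r ^ 2 + n * w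
        - ((P' / r + Q' / r) + 2 * w + W' / r * r ^ 2 + n * (P' / r))
        + ((n + 1) * p + q + w * r ^ 2) * (2 * p + w * r ^ 2)
        - ((n + 3) * p ^ 2 + 2 * p * q + q ^ 2 + 4 * p * w * r ^ 2 + 2 * q * w * r ^ 2
          + w ^ 2 * r ^ 4) := by
    rw [hU, hw, chrisW, ← hp, ← hq, hQ', hP', hp, hq, chrisP, chrisQ, radialRicci]
    field_simp
    ring
  rw [hV, hU]
  ring

end Curvature

/-! ### The eigenvalues of Ricci relative to the metric. -/

section LowestEigenvalue
variable {n : ℕ}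

lemma exists_orthogonal_ne_zero (hn : 2 ≤ n) (x : E n) :
    ∃ v : Fin n → ℝ, v ≠ 0 ∧ ∑ j, x j * v j = 0 := by
  have h : LinearMap.ker (Matrix.mulVecLin (Matrix.of fun (_ : Fin 1) j => x j)) ≠ ⊥ := by
    apply LinearMap.ker_ne_bot_of_finrank_lt
    simp
    omega
  obtain ⟨v, hv, hv0⟩ := (Submodule.ne_bot_iff _).1 h
  refine ⟨v, hv0, ?_⟩
  simpa [Matrix.mulVec, dotProduct] using congrFun (LinearMap.mem_ker.1 hv) 0

/-- An eigenvector orthogonal to x forces μ = α; otherwise pairing the equation with x forces μ = β.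
Dimension at least two is what makes α occur. -/
lemma setOf_eigenvalue_isoMatrix (hn : 2 ≤ n) {x : E n} (hx : x ≠ 0) {a α β : ℝ} (ha : a ≠ 0) :
    {μ : ℝ | ∃ v : Fin n → ℝ, v ≠ 0 ∧ isoMatrix (α * a) ((β - α * a) / ‖x‖ ^ 2) x *ᵥ v
      = μ • (isoMatrix a ((1 - a) / ‖x‖ ^ 2) x *ᵥ v)} = {β, α} := by
  have hr : ‖x‖ ≠ 0 := by simpa using hx
  ext μ
  simp only [isoMatrix_mulVec, mem_ofPred_eq, mem_insert_iff, mem_singleton_iff]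
  constructor
  · rintro ⟨v, hv, h⟩
    set s := ∑ j, x j * v j with hs
    have hi : ∀ i, α * a * v i + (β - α * a) / ‖x‖ ^ 2 * s * x i
        = μ * (a * v i + (1 - a) / ‖x‖ ^ 2 * s * x i) := fun i => congrFun h i
    by_cases h0 : s = 0
    · right
      obtain ⟨i, hvi⟩ := Function.ne_iff.1 hv
      have := hi i
      simp only [h0, mul_zero, zero_mul, add_zero] at this
      have h2 : (μ - α) * (a * v i) = 0 := by linarith
      have h3 := (mul_eq_zero.1 h2).resolve_right (mul_ne_zero ha hvi)
      linarith
    · left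
      have hsum : ∑ i, x i * (α * a * v i + (β - α * a) / ‖x‖ ^ 2 * s * x i)
          = ∑ i, x i * (μ * (a * v i + (1 - a) / ‖x‖ ^ 2 * s * x i)) :=
        Finset.sum_congr rfl fun i _ => by rw [hi i]
      have e1 : ∀ c d : ℝ, ∑ i, x i * (c * v i + d * x i) = c * s + d * ‖x‖ ^ 2 := by
        intro c d
        rw [hs, ← sum_sq_eq_norm_sq, Finset.mul_sum, Finset.mul_sum, ← Finset.sum_add_distrib]
        exact Finset.sum_congr rfl fun i _ => by ring
      have e2 : ∀ i, x i * (μ * (a * v i + (1 - a) / ‖x‖ ^ 2 * s * x i))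
          = x i * (μ * a * v i + μ * ((1 - a) / ‖x‖ ^ 2 * s) * x i) := fun i => by ring
      rw [Finset.sum_congr rfl fun i _ => e2 i, e1, e1] at hsum
      field_simp at hsum
      linarith
  · rintro (rfl | rfl)
    · refine ⟨fun i => x i, fun h => hx ?_, ?_⟩
      · ext i; exact congrFun h i
      · ext i
        simp only [sum_sq_eq_norm_sq, Pi.smul_apply, smul_eq_mul]
        field_simp
        ring
    · obtain ⟨v, hv, h0⟩ := exists_orthogonal_ne_zero hn x
      refine ⟨v, hv, ?_⟩
      ext i
      simp only [h0, Pi.smul_apply, smul_eq_mul]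
      ring

lemma lowestRicci_rotMetric (hn : 2 ≤ n) {J J1 J2 : ℝ → ℝ}
    (hJ : ∀ r, 0 < r → HasDerivAt J (J1 r) r)
    (hJ1 : ∀ r, 0 < r → HasDerivAt J1 (J2 r) r) (hpos : ∀ r, 0 < r → 0 < J r)
    {x : E n} (hx : x ≠ 0) :
    lowestRicci (rotMetric n J) x
      = min (radialRicci n J J2 ‖x‖) (tangentialRicci n J J1 J2 ‖x‖) := by
  have hr : 0 < ‖x‖ := by simpa using hx
  have := hpos _ hr
  rw [lowestRicci, ricci_rotMetric hJ hJ1 hpos hx, rotMetric_eq J hx,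
    setOf_eigenvalue_isoMatrix hn hx (by positivity), csInf_pair]

end LowestEigenvalue

/-! ### Geodesic balls lie in coordinate balls. -/

section GeodesicBall
variable {n : ℕ}

lemma sum_isoMatrix_quadratic (a b : ℝ) (x u : E n) :
    ∑ i, ∑ j, isoMatrix a b x i j * u i * u j = a * ‖u‖ ^ 2 + b * inner ℝ x u ^ 2 := by
  have h : ∀ i, ∑ j, isoMatrix a b x i j * u i * u j = u i * (isoMatrix a b x *ᵥ fun j => u j) i := by
    intro i
    rw [Matrix.mulVec, dotProduct, Finset.mul_sum]
    exact Finset.sum_congr rfl fun j _ => by ring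
  have hin : inner ℝ x u = ∑ j, x j * u j := by simp [PiLp.inner_apply, mul_comm]
  simp only [h, isoMatrix_mulVec, ← hin]
  have h2 : ∀ i, u i * (a * u i + b * inner ℝ x u * x i)
      = a * (u i * u i) + b * inner ℝ x u * (x i * u i) := fun i => by ring
  simp only [h2, Finset.sum_add_distrib, ← Finset.mul_sum, sum_sq_eq_norm_sq, ← hin]
  ring

/-- This is |dr(u)| ≤ |u|_g, multiplied by ‖x‖ so as to make sense at the origin. By Cauchy–Schwarz
the tangential part of the metric is nonnegative. -/
lemma abs_inner_le_norm_mul_sqrt (J : ℝ → ℝ) (x u : E n) :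
    |inner ℝ x u| ≤ ‖x‖ * Real.sqrt (∑ i, ∑ j, rotMetric n J x i j * u i * u j) := by
  rcases eq_or_ne x 0 with rfl | hx
  · simp
  have hr : 0 < ‖x‖ := by simpa using hx
  rw [rotMetric_eq J hx, sum_isoMatrix_quadratic]
  have hcs : inner ℝ x u ^ 2 ≤ ‖x‖ ^ 2 * ‖u‖ ^ 2 := by
    rw [← mul_pow, ← sq_abs]
    exact pow_le_pow_left₀ (abs_nonneg _) (abs_real_inner_le_norm x u) 2
  set a := J ‖x‖ ^ 2 / ‖x‖ ^ 2 with ha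
  have ha0 : 0 ≤ a := by positivity
  have h : (|inner ℝ x u| / ‖x‖) ^ 2 ≤ a * ‖u‖ ^ 2 + (1 - a) / ‖x‖ ^ 2 * inner ℝ x u ^ 2 := by
    have e : a * ‖u‖ ^ 2 + (1 - a) / ‖x‖ ^ 2 * inner ℝ x u ^ 2 - (|inner ℝ x u| / ‖x‖) ^ 2
        = a * (‖x‖ ^ 2 * ‖u‖ ^ 2 - inner ℝ x u ^ 2) / ‖x‖ ^ 2 := by
      rw [div_pow, sq_abs]; field_simp; ring
    have : 0 ≤ a * (‖x‖ ^ 2 * ‖u‖ ^ 2 - inner ℝ x u ^ 2) / ‖x‖ ^ 2 :=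
      div_nonneg (mul_nonneg ha0 (by linarith)) (by positivity)
    linarith
  have := Real.le_sqrt_of_sq_le h
  rwa [div_le_iff₀' hr] at this

lemma norm_le_curveLength (J : ℝ → ℝ) {γ : ℝ → E n} (hγ : ContDiffOn ℝ 1 γ (Icc 0 1))
    (h0 : γ 0 = 0) : ENNReal.ofReal ‖γ 1‖ ≤ curveLength (rotMetric n J) γ := by
  set γ' := derivWithin γ (Icc 0 1) with hγ'
  set F : ℝ → ℝ := fun t => Real.sqrt (∑ i, ∑ j, rotMetric n J (γ t) i j * γ' t i * γ' t j)
  have hcont' : ContinuousOn γ' (Icc 0 1) :=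
    hγ.continuousOn_derivWithin (uniqueDiffOn_Icc zero_lt_one) le_rfl
  have key : ∀ ε : ℝ, 0 < ε →
      ENNReal.ofReal ‖γ 1‖ ≤ curveLength (rotMetric n J) γ + ENNReal.ofReal ε := by
    intro ε hε
    -- The norm of γ need not be differentiable where γ meets the origin; this regularization is,
    -- and its derivative is still bounded by the speed.
    set f : ℝ → ℝ := fun t => Real.sqrt (ε ^ 2 + ‖γ t‖ ^ 2)
    set f' : ℝ → ℝ := fun t => inner ℝ (γ t) (γ' t) / f t
    have hfpos : ∀ t, 0 < f t := fun t => Real.sqrt_pos.2 (by positivity)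
    have hfc : ContinuousOn f (Icc 0 1) :=
      ((continuousOn_const).add (hγ.continuousOn.norm.pow 2)).sqrt
    have hf'c : ContinuousOn f' (Icc 0 1) :=
      (hγ.continuousOn.inner hcont').div hfc fun t _ => (hfpos t).ne'
    have hder : ∀ t ∈ Ioo (0 : ℝ) 1, HasDerivAt f (f' t) t := by
      intro t ht
      have h1 : HasDerivAt γ (γ' t) t :=
        ((hγ.differentiableOn one_ne_zero) t (Ioo_subset_Icc_self ht)).hasDerivWithinAt.hasDerivAt
          (Icc_mem_nhds ht.1 ht.2)
      have h2 := ((h1.norm_sq).const_add (ε ^ 2)).sqrt (by positivity)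
      refine h2.congr_deriv ?_
      simp only [f', f]
      field_simp
    have hint : IntervalIntegrable f' volume 0 1 := by
      apply ContinuousOn.intervalIntegrable
      rwa [uIcc_of_le zero_le_one]
    have hftc := intervalIntegral.integral_eq_sub_of_hasDerivAt_of_le zero_le_one hfc hder hint
    have hle : ∀ t, |f' t| ≤ F t := by
      intro t
      have h1 := abs_inner_le_norm_mul_sqrt J (γ t) (γ' t)
      have h2 : ‖γ t‖ ≤ f t := Real.le_sqrt_of_sq_le (by nlinarith)
      rw [abs_div, abs_of_pos (hfpos t), div_le_iff₀' (hfpos t)]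
      exact h1.trans (mul_le_mul_of_nonneg_right h2 (Real.sqrt_nonneg _))
    have h3 : ENNReal.ofReal (f 1 - f 0) ≤ curveLength (rotMetric n J) γ := by
      rw [← hftc, intervalIntegral.integral_of_le zero_le_one, ← integral_Icc_eq_integral_Ioc]
      refine (ENNReal.ofReal_le_ofReal ((le_abs_self _).trans
        (by simpa using norm_integral_le_integral_norm f'))).trans ?_
      rw [ofReal_integral_eq_lintegral_ofReal]
      · exact lintegral_mono fun t => ENNReal.ofReal_le_ofReal (by simpa using hle t)
      · exact (hf'c.integrableOn_Icc).norm
      · exact ae_of_all _ fun t => abs_nonneg _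
    have hf0 : f 0 = ε := by simp [f, h0, Real.sqrt_sq hε.le]
    have h4 : ‖γ 1‖ ≤ f 1 := Real.le_sqrt_of_sq_le (by nlinarith)
    calc ENNReal.ofReal ‖γ 1‖ ≤ ENNReal.ofReal ((f 1 - f 0) + ε) :=
          ENNReal.ofReal_le_ofReal (by rw [hf0]; linarith)
      _ ≤ ENNReal.ofReal (f 1 - f 0) + ENNReal.ofReal ε := ENNReal.ofReal_add_le
      _ ≤ _ := add_le_add h3 le_rfl
  refine ENNReal.le_of_forall_pos_le_add fun ε hε _ => ?_
  simpa using key ε (by exact_mod_cast hε)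

lemma geodBall_subset_ball (J : ℝ → ℝ) {R : ℝ} (hR : 0 < R) :
    geodBall (rotMetric n J) 0 R ⊆ Metric.ball 0 R := by
  intro y hy
  have h : ENNReal.ofReal ‖y‖ ≤ riemDist (rotMetric n J) 0 y := by
    refine le_iInf fun γ => le_iInf fun hγ => le_iInf fun h0 => le_iInf fun h1 => ?_
    simpa [h1] using norm_le_curveLength J hγ h0
  have h2 := h.trans_lt hy
  rw [ENNReal.ofReal_lt_ofReal_iff hR] at h2
  simpa using h2

end GeodesicBall

/-- `J` is a positive warping function with derivatives `J1` and `J2`, continuous up to the origin,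
closing up smoothly there. -/
structure IsWarping (J J1 J2 : ℝ → ℝ) : Prop where
  continuousOn : ContinuousOn J (Ici 0)
  continuousOn_deriv : ContinuousOn J1 (Ici 0)
  continuousOn_deriv2 : ContinuousOn J2 (Ici 0)
  hasDerivAt : ∀ r, 0 < r → HasDerivAt J (J1 r) r
  hasDerivAt_deriv : ∀ r, 0 < r → HasDerivAt J1 (J2 r) r
  pos : ∀ r, 0 < r → 0 < J r
  zero : J 0 = 0
  deriv_zero : J1 0 = 1

/-! ### The radial quadratic form and its test functions. -/

section OneDimensional

lemma intervalIntegrable_of_continuousOn_Ici {f : ℝ → ℝ} {R : ℝ} (hR : 0 ≤ R)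
    (hf : ContinuousOn f (Ici 0)) : IntervalIntegrable f volume 0 R := by
  apply ContinuousOn.intervalIntegrable
  rw [uIcc_of_le hR]
  exact hf.mono fun x hx => hx.1

/-- The integrand of the radial quadratic form after the first integration by parts. -/
def radialEnergy (m : ℕ) (lam : ℝ) (J J1 h h' : ℝ → ℝ) (r : ℝ) : ℝ :=
  J r ^ (m + 1) * h' r ^ 2 + 2 * lam * (J1 r * J r ^ m * (h r * h' r))
    + lam * (m * J r ^ (m - 1) * h r ^ 2)

variable {J J1 J2 : ℝ → ℝ}

lemma IsWarping.nonneg (hJ : IsWarping J J1 J2) {r : ℝ} (hr : 0 ≤ r) : 0 ≤ J r := by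
  rcases hr.eq_or_lt with rfl | h
  · exact hJ.zero.ge
  · exact (hJ.pos r h).le

lemma IsWarping.continuousOn_radialEnergy (hJ : IsWarping J J1 J2) (m : ℕ) (lam : ℝ)
    {h h' : ℝ → ℝ} (hh : Continuous h) (hh' : Continuous h') :
    ContinuousOn (radialEnergy m lam J J1 h h') (Ici 0) := by
  have := hJ.continuousOn
  have := hJ.continuousOn_deriv
  have := hh.continuousOn (s := Ici 0)
  have := hh'.continuousOn (s := Ici 0)
  unfold radialEnergy
  fun_prop

/-- Integrate (J' J^m)' = J'' J^m + m J'² J^(m-1) against h². At R the boundary term vanishes with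
h; at 0 it is J(0)^m h(0)² = 0^m h(0)², which with 0^0 = 1 is nonzero only in dimension two. -/
lemma IsWarping.integral_tangential (hJ : IsWarping J J1 J2) (m : ℕ) (lam : ℝ) {R : ℝ}
    (hR : 0 < R) {h h' : ℝ → ℝ} (hh : ∀ r, HasDerivAt h (h' r) r) (hh' : Continuous h')
    (hhR : h R = 0) :
    ∫ r in 0..R, (J r ^ (m + 1) * h' r ^ 2
        + lam * ((-(J2 r * J r ^ m) + m * (1 - J1 r ^ 2) * J r ^ (m - 1)) * h r ^ 2))
      = (∫ r in 0..R, radialEnergy m lam J J1 h h' r) + lam * (0 ^ m * h 0 ^ 2) := by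
  have c0 := hJ.continuousOn
  have c1 := hJ.continuousOn_deriv
  have c2 := hJ.continuousOn_deriv2
  have hhc : Continuous h := continuous_iff_continuousAt.2 fun r => (hh r).continuousAt
  have c3 := hhc.continuousOn (s := Ici 0)
  have c4 := hh'.continuousOn (s := Ici 0)
  have hint := intervalIntegrable_of_continuousOn_Ici hR.le
    (f := fun r => J r ^ (m + 1) * h' r ^ 2
        + lam * ((-(J2 r * J r ^ m) + m * (1 - J1 r ^ 2) * J r ^ (m - 1)) * h r ^ 2))
    (by fun_prop)
  have hint2 := intervalIntegrable_of_continuousOn_Ici hR.le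
    (hJ.continuousOn_radialEnergy m lam hhc hh')
  have hftc := intervalIntegral.integral_eq_sub_of_hasDerivAt_of_le hR.le
    (f := fun r => -lam * (J1 r * J r ^ m * h r ^ 2))
    (f' := fun r => (J r ^ (m + 1) * h' r ^ 2
        + lam * ((-(J2 r * J r ^ m) + m * (1 - J1 r ^ 2) * J r ^ (m - 1)) * h r ^ 2))
        - radialEnergy m lam J J1 h h' r)
    (ContinuousOn.mono (s := Ici 0) (by fun_prop) fun x hx => hx.1)
    (fun r hr => by
      refine ((((hJ.hasDerivAt_deriv r hr.1).fun_mul ((hJ.hasDerivAt r hr.1).fun_pow m)).fun_mul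
        ((hh r).fun_pow 2)).const_mul (-lam)).congr_deriv ?_
      simp only [radialEnergy]
      push_cast
      ring)
    (hint.sub hint2)
  rw [intervalIntegral.integral_sub hint hint2] at hftc
  rw [← sub_eq_iff_eq_add', hftc, hhR, hJ.zero, hJ.deriv_zero]
  ring

/-- A smooth cutoff to `(0, R)`, equal to one on compact subsets for large `j`. -/
noncomputable def intervalCutoff (R : ℝ) (j : ℕ) (r : ℝ) : ℝ :=
  Real.smoothTransition ((j + 1) * r - 1) * Real.smoothTransition ((j + 1) * (R - r) - 1)

lemma contDiff_intervalCutoff (R : ℝ) (j : ℕ) : ContDiff ℝ ∞ (intervalCutoff R j) := by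
  unfold intervalCutoff
  exact (Real.smoothTransition.contDiff.comp (by fun_prop)).mul
    (Real.smoothTransition.contDiff.comp (by fun_prop))

lemma intervalCutoff_nonneg (R : ℝ) (j : ℕ) (r : ℝ) : 0 ≤ intervalCutoff R j r :=
  mul_nonneg (Real.smoothTransition.nonneg _) (Real.smoothTransition.nonneg _)

lemma intervalCutoff_le_one (R : ℝ) (j : ℕ) (r : ℝ) : intervalCutoff R j r ≤ 1 :=
  mul_le_one₀ (Real.smoothTransition.le_one _) (Real.smoothTransition.nonneg _)
    (Real.smoothTransition.le_one _)

lemma intervalCutoff_eq_zero_left {R : ℝ} {j : ℕ} {r : ℝ} (hr : r ≤ 1 / (j + 1)) :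
    intervalCutoff R j r = 0 := by
  have h1 : (0 : ℝ) < j + 1 := by positivity
  rw [intervalCutoff, Real.smoothTransition.zero_of_nonpos, zero_mul]
  rw [le_div_iff₀' h1] at hr
  linarith

lemma intervalCutoff_eq_zero_right {R : ℝ} {j : ℕ} {r : ℝ} (hr : R ≤ r) :
    intervalCutoff R j r = 0 := by
  have h1 : (0 : ℝ) < j + 1 := by positivity
  rw [intervalCutoff, Real.smoothTransition.zero_of_nonpos (x := (j + 1) * (R - r) - 1), mul_zero]
  nlinarith

lemma tendsto_intervalCutoff {R r : ℝ} (h0 : 0 < r) (hR : r < R) :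
    Filter.Tendsto (fun j => intervalCutoff R j r) Filter.atTop (nhds 1) := by
  apply tendsto_const_nhds.congr'
  have key : ∀ c : ℝ, 0 < c → ∀ᶠ j : ℕ in Filter.atTop, 1 ≤ ((j : ℝ) + 1) * c - 1 := by
    intro c hc
    filter_upwards [(tendsto_natCast_atTop_atTop (R := ℝ)).eventually_ge_atTop (2 / c)] with j hj
    rw [div_le_iff₀ hc] at hj
    linarith
  filter_upwards [key r h0, key (R - r) (by linarith)] with j h1 h2
  rw [intervalCutoff, Real.smoothTransition.one_of_one_le h1,
    Real.smoothTransition.one_of_one_le h2, one_mul]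

lemma hasDerivAt_neg_primitive {k : ℝ → ℝ} (hk : Continuous k) (R r : ℝ) :
    HasDerivAt (fun u => ∫ s in u..R, k s) (-k r) r :=
  intervalIntegral.integral_hasDerivAt_left (hk.intervalIntegrable _ _)
    hk.aestronglyMeasurable.stronglyMeasurableAtFilter hk.continuousAt

/-- Nonnegativity of the radial form on smooth functions constant near the origin extends to the
antiderivatives of continuous functions. -/
lemma IsWarping.radialEnergy_nonneg_of_smooth (hJ : IsWarping J J1 J2) (m : ℕ) {lam : ℝ}
    (hlam : 0 ≤ lam) {R : ℝ} (hR : 0 < R)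
    (H : ∀ h : ℝ → ℝ, ContDiff ℝ ∞ h → (∃ ε > 0, ∀ r ≤ ε, h r = h 0) → (∀ r ≥ R, h r = 0) →
      0 ≤ (∫ r in 0..R, radialEnergy m lam J J1 h (deriv h) r) + lam * (0 ^ m * h 0 ^ 2))
    {k : ℝ → ℝ} (hk : ContDiff ℝ ∞ k) :
    0 ≤ (∫ r in 0..R, radialEnergy m lam J J1 (fun r => ∫ s in r..R, k s) (fun r => -k r) r)
      + lam * (0 ^ m * (∫ s in 0..R, k s) ^ 2) := by
  obtain ⟨K, hK⟩ : ∃ K, ∀ r ∈ Icc 0 R, ‖k r‖ ≤ K :=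
    isCompact_Icc.exists_bound_of_continuousOn hk.continuous.continuousOn
  have hK0 : 0 ≤ K := (norm_nonneg _).trans (hK 0 ⟨le_rfl, hR.le⟩)
  -- The cutoff acts on the derivative and not on h: the antiderivative is then constant near 0 and
  -- zero beyond R, and no derivative of the cutoff appears, so h and h' stay bounded uniformly in
  -- j.
  set kj : ℕ → ℝ → ℝ := fun j r => k r * intervalCutoff R j r with hkj
  have hkjs : ∀ j, ContDiff ℝ ∞ (kj j) := fun j => hk.mul (contDiff_intervalCutoff R j)
  set hj : ℕ → ℝ → ℝ := fun j r => ∫ s in r..R, kj j s with hhj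
  have hd : ∀ j r, HasDerivAt (hj j) (-kj j r) r :=
    fun j r => hasDerivAt_neg_primitive (hkjs j).continuous R r
  have hderiv : ∀ j, deriv (hj j) = fun r => -kj j r := fun j => funext fun r => (hd j r).deriv
  have hkb : ∀ j, ∀ r ∈ Icc 0 R, ‖kj j r‖ ≤ K := by
    intro j r hr
    rw [norm_mul]
    have h2 : ‖intervalCutoff R j r‖ ≤ 1 := by
      rw [Real.norm_of_nonneg (intervalCutoff_nonneg _ _ _)]
      exact intervalCutoff_le_one _ _ _
    exact (mul_le_of_le_one_right (norm_nonneg _) h2).trans (hK r hr)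
  have hklim : ∀ r, 0 < r → r < R →
      Filter.Tendsto (fun j => kj j r) Filter.atTop (nhds (k r)) := by
    intro r h0 h1
    simpa using (tendsto_intervalCutoff h0 h1).const_mul (k r)
  -- At R every cutoff vanishes, so pointwise convergence fails there.
  have hae : ∀ᵐ s : ℝ, s ≠ R := by simp [ae_iff, measure_singleton]
  have hhlim : ∀ r, 0 ≤ r → r ≤ R →
      Filter.Tendsto (fun j => hj j r) Filter.atTop (nhds (∫ s in r..R, k s)) := by
    intro r h0 h1
    apply intervalIntegral.tendsto_integral_filter_of_dominated_convergence (fun _ => K)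
    · exact .of_forall fun j => (hkjs j).continuous.aestronglyMeasurable
    · refine .of_forall fun j => ae_of_all _ fun s hs => hkb j s ?_
      rw [uIoc_of_le h1] at hs
      exact ⟨h0.trans hs.1.le, hs.2⟩
    · exact intervalIntegrable_const
    · filter_upwards [hae] with s hsR hs
      rw [uIoc_of_le h1] at hs
      exact hklim s (h0.trans_lt hs.1) (lt_of_le_of_ne hs.2 hsR)
  have hhb : ∀ j, ∀ r ∈ Icc 0 R, ‖hj j r‖ ≤ K * R := by
    intro j r hr
    refine (intervalIntegral.norm_integral_le_of_norm_le_const (C := K) fun s hs => hkb j s ?_).trans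
      ?_
    · rw [uIoc_of_le hr.2] at hs
      exact ⟨hr.1.trans hs.1.le, hs.2⟩
    · rw [abs_of_nonneg (by linarith [hr.2])]
      exact mul_le_mul_of_nonneg_left (by linarith [hr.1]) hK0
  have hnn : ∀ j, 0 ≤ (∫ r in 0..R, radialEnergy m lam J J1 (hj j) (fun r => -kj j r) r)
      + lam * (0 ^ m * hj j 0 ^ 2) := by
    intro j
    rw [← hderiv j]
    apply H
    · rw [contDiff_infty_iff_deriv, hderiv j]
      exact ⟨fun r => (hd j r).differentiableAt, (hkjs j).neg⟩
    · refine ⟨1 / (j + 1), by positivity, fun r hr => ?_⟩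
      have h1 : hj j r = (∫ s in r..0, kj j s) + hj j 0 :=
        (intervalIntegral.integral_add_adjacent_intervals
          ((hkjs j).continuous.intervalIntegrable _ _)
          ((hkjs j).continuous.intervalIntegrable _ _)).symm
      rw [h1, intervalIntegral.integral_zero_ae, zero_add]
      refine ae_of_all _ fun s hs => ?_
      have hs1 : s ≤ 1 / (j + 1) := hs.2.trans (max_le hr (by positivity))
      simp [hkj, intervalCutoff_eq_zero_left hs1]
    · intro r hr
      refine intervalIntegral.integral_zero_ae (ae_of_all _ fun s hs => ?_)
      have hs1 : R ≤ s := (le_min hr le_rfl).trans hs.1.le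
      simp [hkj, intervalCutoff_eq_zero_right hs1]
  refine ge_of_tendsto' (Filter.Tendsto.add ?_ ((((hhlim 0 le_rfl hR.le).pow 2).const_mul
    _).const_mul _)) hnn
  have c0 := hJ.continuousOn
  have c1 := hJ.continuousOn_deriv
  apply intervalIntegral.tendsto_integral_filter_of_dominated_convergence
    (fun r => J r ^ (m + 1) * K ^ 2 + 2 * lam * (|J1 r| * J r ^ m * (K * R * K))
      + lam * (m * J r ^ (m - 1) * (K * R) ^ 2))
  · refine .of_forall fun j => ?_
    have := (intervalIntegrable_of_continuousOn_Ici hR.le (hJ.continuousOn_radialEnergy m lam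
      (continuous_iff_continuousAt.2 fun r => (hd j r).continuousAt)
      (hkjs j).continuous.neg)).aestronglyMeasurable
    rwa [uIoc_of_le hR.le]
  · refine .of_forall fun j => ae_of_all _ fun r hr => ?_
    rw [uIoc_of_le hR.le] at hr
    have hr' : r ∈ Icc 0 R := ⟨hr.1.le, hr.2⟩
    have hJr := hJ.nonneg hr.1.le
    have b1 := hkb j r hr'
    have b2 := hhb j r hr'
    refine (norm_add₃_le).trans (add_le_add_three ?_ ?_ ?_)
    · rw [norm_mul, norm_pow, norm_pow, norm_neg, Real.norm_of_nonneg hJr]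
      gcongr
    · simp only [norm_mul, norm_pow, norm_neg, Real.norm_of_nonneg hJr, Real.norm_of_nonneg hlam,
        Real.norm_ofNat, Real.norm_eq_abs (J1 r)]
      gcongr
    · simp only [norm_mul, norm_pow, Real.norm_of_nonneg hJr, Real.norm_of_nonneg hlam,
        Real.norm_natCast]
      gcongr
  · exact intervalIntegrable_of_continuousOn_Ici hR.le (by fun_prop)
  · filter_upwards [hae] with r hrR hr
    rw [uIoc_of_le hR.le] at hr
    have t1 := (hklim r hr.1 (lt_of_le_of_ne hr.2 hrR)).neg
    have t2 := hhlim r hr.1.le hr.2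
    exact (((t1.pow 2).const_mul _).add (((t2.mul t1).const_mul _).const_mul _)).add
      (((t2.pow 2).const_mul _).const_mul _)

end OneDimensional

/-! ### The weighted volume estimate for a power test function. -/

section Estimate
variable {J J1 J2 : ℝ → ℝ}

lemma hasDerivAt_one_sub_div_pow (R : ℝ) (N : ℕ) (r : ℝ) :
    HasDerivAt (fun r : ℝ => (1 - r / R) ^ (N + 1)) (-((N + 1) / R * (1 - r / R) ^ N)) r := by
  refine (((hasDerivAt_id' r).div_const R).const_sub 1 |>.fun_pow (N + 1)).congr_deriv ?_
  push_cast
  simp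
  ring

lemma integral_one_sub_div_pow {R : ℝ} (hR : 0 < R) (N : ℕ) (r : ℝ) :
    ∫ s in r..R, (N + 1) / R * (1 - s / R) ^ N = (1 - r / R) ^ (N + 1) := by
  rw [intervalIntegral.integral_eq_sub_of_hasDerivAt (f := fun r => -(1 - r / R) ^ (N + 1))
    (fun s _ => ((hasDerivAt_one_sub_div_pow R N s).fun_neg).congr_deriv (neg_neg _))
    (Continuous.intervalIntegrable (by fun_prop) _ _)]
  simp [div_self hR.ne']

/-- Integrating the derivative of J^(m+1) (1 - r/R)^(2M+1) expresses the cross term through the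
weighted volume. Both boundary terms vanish, by J(0) = 0 and by the weight at R. -/
lemma IsWarping.weighted_estimate (hJ : IsWarping J J1 J2) (m : ℕ) {lam : ℝ}
    {R : ℝ} (hR : 0 < R) (M : ℕ)
    (H : 0 ≤ (∫ r in 0..R, radialEnergy m lam J J1 (fun r => (1 - r / R) ^ (M + 1))
      (fun r => -((M + 1) / R * (1 - r / R) ^ M)) r) + lam * 0 ^ m) :
    (2 * lam * (M + 1) * (2 * M + 1) / (m + 1) - (M + 1) ^ 2)
        * ∫ r in 0..R, J r ^ (m + 1) * (1 - r / R) ^ (2 * M)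
      ≤ R ^ 2 * (lam * (∫ r in 0..R, m * J r ^ (m - 1) * (1 - r / R) ^ (2 * (M + 1)))
        + lam * 0 ^ m) := by
  have c0 := hJ.continuousOn
  have c1 := hJ.continuousOn_deriv
  have i1 := intervalIntegrable_of_continuousOn_Ici hR.le
    (f := fun r => J r ^ (m + 1) * (1 - r / R) ^ (2 * M)) (by fun_prop)
  have i2 := intervalIntegrable_of_continuousOn_Ici hR.le
    (f := fun r => J1 r * J r ^ m * (1 - r / R) ^ (2 * M + 1)) (by fun_prop)
  have i3 := intervalIntegrable_of_continuousOn_Ici hR.le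
    (f := fun r => m * J r ^ (m - 1) * (1 - r / R) ^ (2 * (M + 1))) (by fun_prop)
  have hibp : (m + 1) * (∫ r in 0..R, J1 r * J r ^ m * (1 - r / R) ^ (2 * M + 1))
      - (2 * M + 1) / R * (∫ r in 0..R, J r ^ (m + 1) * (1 - r / R) ^ (2 * M)) = 0 := by
    have hftc := intervalIntegral.integral_eq_sub_of_hasDerivAt_of_le hR.le
      (f := fun r => J r ^ (m + 1) * (1 - r / R) ^ (2 * M + 1))
      (f' := fun r => (m + 1) * (J1 r * J r ^ m * (1 - r / R) ^ (2 * M + 1))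
        - (2 * M + 1) / R * (J r ^ (m + 1) * (1 - r / R) ^ (2 * M)))
      (ContinuousOn.mono (s := Ici 0) (by fun_prop) fun x hx => hx.1)
      (fun r hr => by
        refine (((hJ.hasDerivAt r hr.1).fun_pow (m + 1)).fun_mul
          (hasDerivAt_one_sub_div_pow R (2 * M) r)).congr_deriv ?_
        push_cast
        ring)
      ((i2.const_mul _).sub (i1.const_mul _))
    rw [intervalIntegral.integral_sub (i2.const_mul _) (i1.const_mul _),
      intervalIntegral.integral_const_mul, intervalIntegral.integral_const_mul] at hftc
    rw [hftc, hJ.zero, div_self hR.ne']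
    simp
  have hE : ∫ r in 0..R, radialEnergy m lam J J1 (fun r => (1 - r / R) ^ (M + 1))
      (fun r => -((M + 1) / R * (1 - r / R) ^ M)) r
      = ((M + 1) / R) ^ 2 * (∫ r in 0..R, J r ^ (m + 1) * (1 - r / R) ^ (2 * M))
        - 2 * lam * ((M + 1) / R)
          * (∫ r in 0..R, J1 r * J r ^ m * (1 - r / R) ^ (2 * M + 1))
        + lam * (∫ r in 0..R, m * J r ^ (m - 1) * (1 - r / R) ^ (2 * (M + 1))) := by
    rw [← intervalIntegral.integral_const_mul, ← intervalIntegral.integral_const_mul,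
      ← intervalIntegral.integral_const_mul,
      ← intervalIntegral.integral_sub (i1.const_mul _) (i2.const_mul _),
      ← intervalIntegral.integral_add ((i1.const_mul _).sub (i2.const_mul _)) (i3.const_mul _)]
    refine intervalIntegral.integral_congr fun r _ => ?_
    simp only [radialEnergy]
    ring
  rw [hE] at H
  generalize (∫ r in 0..R, J r ^ (m + 1) * (1 - r / R) ^ (2 * M)) = S at *
  generalize (∫ r in 0..R, J1 r * J r ^ m * (1 - r / R) ^ (2 * M + 1)) = T at *
  generalize (∫ r in 0..R, m * J r ^ (m - 1) * (1 - r / R) ^ (2 * (M + 1))) = U at *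
  have hT : T = (2 * M + 1) / R * S / (m + 1) := by
    field_simp
    field_simp at hibp
    linarith
  rw [hT] at H
  have h2 := mul_nonneg (sq_nonneg R) H
  have e : R ^ 2 * (((M + 1) / R) ^ 2 * S - 2 * lam * ((M + 1) / R)
      * ((2 * M + 1) / R * S / (m + 1)) + lam * U + lam * 0 ^ m)
      = R ^ 2 * (lam * U + lam * 0 ^ m)
        - (2 * lam * (M + 1) * (2 * M + 1) / (m + 1) - (M + 1) ^ 2) * S := by
    field_simp
    ring
  linarith

/-- A Young-type inequality by dichotomy: if R ≤ δ t, trade R² for (δ t)²; otherwise t ≤ R/δ. The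
factor m disposes of m = 0, where the exponent m - 1 is truncated. -/
lemma natCast_mul_pow_pred_le (m : ℕ) {R δ t : ℝ} (hR : 0 < R) (hδ : 0 < δ) (ht : 0 ≤ t) :
    R ^ 2 * (m * t ^ (m - 1)) ≤ m * (δ ^ 2 * t ^ (m + 1) + R ^ (m + 1) * δ⁻¹ ^ (m - 1)) := by
  rcases m with _ | m
  · simp
  simp only [Nat.add_sub_cancel]
  suffices h : R ^ 2 * t ^ m ≤ δ ^ 2 * t ^ (m + 2) + R ^ (m + 2) * δ⁻¹ ^ m by
    calc R ^ 2 * (((m + 1 : ℕ) : ℝ) * t ^ m) = ((m + 1 : ℕ) : ℝ) * (R ^ 2 * t ^ m) := by ring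
      _ ≤ _ := mul_le_mul_of_nonneg_left h (by positivity)
  rcases le_total R (δ * t) with h | h
  · have h1 : R ^ 2 * t ^ m ≤ (δ * t) ^ 2 * t ^ m := by gcongr
    have h2 : 0 ≤ R ^ (m + 2) * δ⁻¹ ^ m := by positivity
    calc R ^ 2 * t ^ m ≤ (δ * t) ^ 2 * t ^ m := h1
      _ = δ ^ 2 * t ^ (m + 2) := by ring
      _ ≤ _ := by linarith
  · have h1 : t ≤ R * δ⁻¹ := by rw [← div_eq_mul_inv, le_div_iff₀' hδ]; exact h
    have h2 : 0 ≤ δ ^ 2 * t ^ (m + 2) := by positivity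
    calc R ^ 2 * t ^ m ≤ R ^ 2 * (R * δ⁻¹) ^ m := by gcongr
      _ = R ^ (m + 2) * δ⁻¹ ^ m := by ring
      _ ≤ _ := by linarith

/-- By `hκδ`, the δ² part of the Young-type inequality costs at most half of κ S and is absorbed on
the left. -/
lemma IsWarping.integral_pow_le (hJ : IsWarping J J1 J2) (m : ℕ) {lam κ δ : ℝ} (hlam : 0 ≤ lam)
    {R : ℝ} (hR : 0 < R) (M : ℕ) (hδ : 0 < δ) (hκδ : lam * m * δ ^ 2 ≤ κ / 2) (hκ : 0 < κ)
    (H : κ * ∫ r in 0..2 * R, J r ^ (m + 1) * (1 - r / (2 * R)) ^ (2 * M)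
      ≤ (2 * R) ^ 2 * (lam * (∫ r in 0..2 * R, m * J r ^ (m - 1)
          * (1 - r / (2 * R)) ^ (2 * (M + 1))) + lam * 0 ^ m)) :
    ∫ r in 0..R, J r ^ (m + 1)
      ≤ 4 ^ M * (2 / κ * (lam * m * δ⁻¹ ^ (m - 1) + lam)) * (2 * R) ^ (m + 2) := by
  have c0 := hJ.continuousOn
  set L := 2 * R with hL
  have hL0 : 0 < L := by positivity
  have i1 := intervalIntegrable_of_continuousOn_Ici hL0.le
    (f := fun r => J r ^ (m + 1) * (1 - r / L) ^ (2 * M)) (by fun_prop)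
  have i3 := intervalIntegrable_of_continuousOn_Ici hL0.le
    (f := fun r => m * J r ^ (m - 1) * (1 - r / L) ^ (2 * (M + 1))) (by fun_prop)
  set S := ∫ r in 0..L, J r ^ (m + 1) * (1 - r / L) ^ (2 * M) with hS
  have hU : L ^ 2 * ∫ r in 0..L, m * J r ^ (m - 1) * (1 - r / L) ^ (2 * (M + 1))
      ≤ m * δ ^ 2 * S + m * (L ^ (m + 1) * δ⁻¹ ^ (m - 1)) * L := by
    have e : m * δ ^ 2 * S + m * (L ^ (m + 1) * δ⁻¹ ^ (m - 1)) * L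
        = ∫ r in 0..L, (m * δ ^ 2 * (J r ^ (m + 1) * (1 - r / L) ^ (2 * M))
          + m * (L ^ (m + 1) * δ⁻¹ ^ (m - 1))) := by
      rw [intervalIntegral.integral_add (i1.const_mul _) intervalIntegrable_const,
        intervalIntegral.integral_const_mul, intervalIntegral.integral_const]
      simp [hS, mul_comm L]
    rw [e, ← intervalIntegral.integral_const_mul]
    refine intervalIntegral.integral_mono_on hL0.le (i3.const_mul _)
      ((i1.const_mul _).add intervalIntegrable_const) fun r hr => ?_
    have hs0 : 0 ≤ 1 - r / L := by
      rw [sub_nonneg, div_le_one hL0]; exact hr.2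
    have hs1 : 1 - r / L ≤ 1 := by
      have : 0 ≤ r / L := div_nonneg hr.1 hL0.le
      linarith
    have hJr := hJ.nonneg hr.1
    have hp1 : (1 - r / L) ^ (2 * (M + 1)) ≤ (1 - r / L) ^ (2 * M) :=
      pow_le_pow_of_le_one hs0 hs1 (by omega)
    have hp2 : (1 - r / L) ^ (2 * M) ≤ 1 := pow_le_one₀ hs0 hs1
    have hp0 : 0 ≤ (1 - r / L) ^ (2 * M) := by positivity
    have hy := natCast_mul_pow_pred_le m hL0 hδ hJr
    have hc : 0 ≤ m * (L ^ (m + 1) * δ⁻¹ ^ (m - 1)) := by positivity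
    calc L ^ 2 * (m * J r ^ (m - 1) * (1 - r / L) ^ (2 * (M + 1)))
        ≤ L ^ 2 * (m * J r ^ (m - 1) * (1 - r / L) ^ (2 * M)) := by gcongr
      _ = L ^ 2 * (m * J r ^ (m - 1)) * (1 - r / L) ^ (2 * M) := by ring
      _ ≤ m * (δ ^ 2 * J r ^ (m + 1) + L ^ (m + 1) * δ⁻¹ ^ (m - 1)) * (1 - r / L) ^ (2 * M) := by
        gcongr
      _ = m * δ ^ 2 * (J r ^ (m + 1) * (1 - r / L) ^ (2 * M))
          + m * (L ^ (m + 1) * δ⁻¹ ^ (m - 1)) * (1 - r / L) ^ (2 * M) := by ring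
      _ ≤ _ := by
        have := mul_le_of_le_one_right hc hp2
        linarith
  have h0m : L ^ 2 * (0 : ℝ) ^ m ≤ L ^ (m + 2) := by
    rcases m with _ | m
    · simp
    · simp; positivity
  have hS0 : 0 ≤ S := intervalIntegral.integral_nonneg hL0.le fun r hr =>
    mul_nonneg (pow_nonneg (hJ.nonneg hr.1) _) (by rw [pow_mul]; positivity)
  have hSle : κ / 2 * S ≤ (lam * m * δ⁻¹ ^ (m - 1) + lam) * L ^ (m + 2) := by
    have a1 := mul_le_mul_of_nonneg_left hU hlam
    have a2 := mul_le_mul_of_nonneg_left h0m hlam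
    have a3 := mul_le_mul_of_nonneg_right hκδ hS0
    have e : lam * (m * (L ^ (m + 1) * δ⁻¹ ^ (m - 1)) * L)
        = lam * m * δ⁻¹ ^ (m - 1) * L ^ (m + 2) := by ring
    nlinarith
  have hres : ∫ r in 0..R, J r ^ (m + 1) ≤ 4 ^ M * S := by
    have hRL : R ≤ L := by linarith
    have j1 := intervalIntegrable_of_continuousOn_Ici hR.le
      (f := fun r => J r ^ (m + 1) * (1 - r / L) ^ (2 * M)) (by fun_prop)
    have hsub : ∫ r in 0..R, J r ^ (m + 1) * (1 - r / L) ^ (2 * M) ≤ S := by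
      apply intervalIntegral.integral_mono_interval le_rfl hR.le hRL _ i1
      filter_upwards [ae_restrict_mem measurableSet_Ioc] with r hr
      exact mul_nonneg (pow_nonneg (hJ.nonneg hr.1.le) _) (by rw [pow_mul]; positivity)
    refine le_trans ?_ (mul_le_mul_of_nonneg_left hsub (by positivity))
    rw [← intervalIntegral.integral_const_mul]
    refine intervalIntegral.integral_mono_on hR.le
      (intervalIntegrable_of_continuousOn_Ici hR.le (by fun_prop)) (j1.const_mul _) fun r hr => ?_
    have hh : 1 / 2 ≤ 1 - r / L := by
      have : r / L ≤ 1 / 2 := by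
        rw [div_le_iff₀ hL0]; linarith [hr.2]
      linarith
    -- On [0, R] the base of the weight is at least 1/2, as L = 2R; this is the source of 4^M.
    have h4 : 1 ≤ 4 ^ M * (1 - r / L) ^ (2 * M) := by
      rw [pow_mul, ← mul_pow]
      exact one_le_pow₀ (by nlinarith)
    calc J r ^ (m + 1) ≤ J r ^ (m + 1) * (4 ^ M * (1 - r / L) ^ (2 * M)) :=
          le_mul_of_one_le_right (pow_nonneg (hJ.nonneg hr.1) _) h4
      _ = _ := by ring
  refine hres.trans ?_
  rw [mul_assoc]
  refine mul_le_mul_of_nonneg_left ?_ (by positivity)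
  have : S = 2 / κ * (κ / 2 * S) := by field_simp
  rw [this, mul_assoc]
  exact mul_le_mul_of_nonneg_left hSle (by positivity)

end Estimate

/-! ### Polar coordinates, and passage from the operator to the radial form. -/

section Volume
variable {J J1 J2 : ℝ → ℝ}

lemma isWarping_derivWithin (hJ : ContDiffOn ℝ ∞ J (Ici 0)) (h0 : J 0 = 0)
    (h1 : derivWithin J (Ici 0) 0 = 1) (hpos : ∀ r, 0 < r → 0 < J r) :
    IsWarping J (derivWithin J (Ici 0)) (derivWithin (derivWithin J (Ici 0)) (Ici 0)) := by
  have hu : UniqueDiffOn ℝ (Ici (0 : ℝ)) := uniqueDiffOn_Ici 0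
  have hd : ∀ f : ℝ → ℝ, ContDiffOn ℝ ∞ f (Ici 0) →
      ∀ r, 0 < r → HasDerivAt f (derivWithin f (Ici 0) r) r := fun f hf r hr =>
    ((hf.differentiableOn (by simp)) r hr.le).hasDerivWithinAt.hasDerivAt (Ici_mem_nhds hr)
  have hJ1 : ContDiffOn ℝ ∞ (derivWithin J (Ici 0)) (Ici 0) := hJ.derivWithin hu (by simp)
  exact ⟨hJ.continuousOn, hJ1.continuousOn, (hJ1.derivWithin hu (m := ∞) (by simp)).continuousOn,
    hd J hJ, hd _ hJ1, hpos, h0, h1⟩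

/-- The constant `dim * vol (unit ball)` of integration in polar coordinates on `ℝ^{m+2}`. -/
noncomputable def polarConst (m : ℕ) : ℝ :=
  (m + 2 : ℕ) * (volume : Measure (E (m + 2))).real (Metric.ball 0 1)

lemma polarConst_pos (m : ℕ) : 0 < polarConst m := by
  have : 0 < (volume : Measure (E (m + 2))).real (Metric.ball 0 1) :=
    ENNReal.toReal_pos (Metric.measure_ball_pos _ _ one_pos).ne' measure_ball_lt_top.ne
  unfold polarConst
  positivity

/-- The Riemannian density is (J/r)^(m+1), whose denominator cancels the polar Jacobian; hence this
normalization. -/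
lemma integral_radial_div_pow (m : ℕ) (F : ℝ → ℝ) :
    ∫ x : E (m + 2), F ‖x‖ / ‖x‖ ^ (m + 1) = polarConst m * ∫ r in Ioi (0 : ℝ), F r := by
  have h := integral_fun_norm_addHaar (volume : Measure (E (m + 2)))
    (fun r => F r / r ^ (m + 1))
  rw [h, finrank_euclideanSpace_fin, nsmul_eq_mul, smul_eq_mul, ← mul_assoc]
  congr 1
  refine setIntegral_congr_fun measurableSet_Ioi fun r hr => ?_
  have : r ≠ 0 := (mem_Ioi.1 hr).ne'
  simp only [smul_eq_mul, show m + 2 - 1 = m + 1 from rfl]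
  field_simp

lemma integrable_radial_div_pow (m : ℕ) {F : ℝ → ℝ} (hF : IntegrableOn F (Ioi 0)) :
    Integrable (fun x : E (m + 2) => F ‖x‖ / ‖x‖ ^ (m + 1)) := by
  refine (integrable_fun_norm_addHaar (volume : Measure (E (m + 2)))
    (f := fun r => F r / r ^ (m + 1))).2 ?_
  rw [finrank_euclideanSpace_fin]
  refine hF.congr_fun (fun r hr => ?_) measurableSet_Ioi
  have : r ≠ 0 := (mem_Ioi.1 hr).ne'
  simp only [smul_eq_mul, show m + 2 - 1 = m + 1 from rfl]
  field_simp

lemma IsWarping.ae_sqrt_det (hJ : IsWarping J J1 J2) (m : ℕ) :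
    ∀ᵐ x : E (m + 2), x ≠ 0 ∧
      Real.sqrt (rotMetric (m + 2) J x).det = J ‖x‖ ^ (m + 1) / ‖x‖ ^ (m + 1) := by
  have h0 : ∀ᵐ x : E (m + 2), x ≠ 0 := by simp [ae_iff, measure_singleton]
  filter_upwards [h0] with x hx
  refine ⟨hx, ?_⟩
  rw [sqrt_det_rotMetric (by omega) hx (hJ.pos _ (by simpa using hx)), div_pow]
  rfl

lemma IsWarping.vol_ball (hJ : IsWarping J J1 J2) (m : ℕ) {R : ℝ} (hR : 0 < R) :
    vol (rotMetric (m + 2) J) (Metric.ball 0 R)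
      = ENNReal.ofReal (polarConst m * ∫ r in 0..R, J r ^ (m + 1)) := by
  set F : ℝ → ℝ := (Iio R).indicator fun r => J r ^ (m + 1) with hF
  have hFi : IntegrableOn F (Ioi 0) := by
    rw [hF, IntegrableOn, integrable_indicator_iff measurableSet_Iio, IntegrableOn,
      Measure.restrict_restrict measurableSet_Iio]
    have := (intervalIntegrable_of_continuousOn_Ici hR.le (hJ.continuousOn.pow (m + 1))).1
    exact this.mono_set fun r hr => ⟨hr.2, (mem_Iio.1 hr.1).le⟩
  have hFint : ∫ r in Ioi (0 : ℝ), F r = ∫ r in 0..R, J r ^ (m + 1) := by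
    rw [hF, setIntegral_indicator measurableSet_Iio, intervalIntegral.integral_of_le hR.le,
      Ioi_inter_Iio, integral_Ioc_eq_integral_Ioo]
  have hpos : ∀ x : E (m + 2), 0 ≤ F ‖x‖ / ‖x‖ ^ (m + 1) := fun x =>
    div_nonneg (indicator_apply_nonneg fun _ => pow_nonneg (hJ.nonneg (norm_nonneg x)) _)
      (by positivity)
  rw [vol, withDensity_apply _ measurableSet_ball, ← hFint, ← integral_radial_div_pow,
    ofReal_integral_eq_lintegral_ofReal (integrable_radial_div_pow m hFi) (ae_of_all _ hpos),
    ← lintegral_indicator measurableSet_ball]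
  refine lintegral_congr_ae ?_
  filter_upwards [hJ.ae_sqrt_det m] with x hx
  by_cases hxR : ‖x‖ < R
  · rw [indicator_of_mem (by simpa using hxR), hx.2, hF, indicator_of_mem (by exact hxR)]
  · rw [indicator_of_notMem (by simpa using hxR), hF, indicator_of_notMem (by simpa using hxR)]
    simp

lemma contDiff_radial {n : ℕ} {h : ℝ → ℝ} (hh : ContDiff ℝ ∞ h) {ε : ℝ} (hε : 0 < ε)
    (hc : ∀ r ≤ ε, h r = h 0) : ContDiff ℝ ∞ (fun x : E n => h ‖x‖) := by
  rw [contDiff_iff_contDiffAt]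
  intro x
  rcases eq_or_ne x 0 with rfl | hx
  · refine (contDiffAt_const (c := h 0)).congr_of_eventuallyEq ?_
    filter_upwards [Metric.ball_mem_nhds (0 : E n) hε] with y hy
    exact hc _ (by simpa using (mem_ball_zero_iff.1 hy).le)
  · exact hh.contDiffAt.comp x (contDiffAt_norm ℝ hx)

lemma IsWarping.radial_nonneg (hJ : IsWarping J J1 J2) (m : ℕ) {lam : ℝ} (hlam : 0 ≤ lam)
    (H : SchrodingerNonneg (rotMetric (m + 2) J)
      (fun x => lam * lowestRicci (rotMetric (m + 2) J) x))
    {R : ℝ} (hR : 0 < R) {h : ℝ → ℝ} (hh : ContDiff ℝ ∞ h) (hc : ∃ ε > 0, ∀ r ≤ ε, h r = h 0)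
    (hz : ∀ r ≥ R, h r = 0) :
    0 ≤ (∫ r in 0..R, radialEnergy m lam J J1 h (deriv h) r) + lam * (0 ^ m * h 0 ^ 2) := by
  obtain ⟨ε, hε, hc⟩ := hc
  have hdiff : ∀ r, HasDerivAt h (deriv h r) r := fun r =>
    (hh.differentiable (by simp) r).hasDerivAt
  have hd : Continuous (deriv h) := hh.continuous_deriv (by simp)
  have hdz : ∀ r, R < r → deriv h r = 0 := by
    intro r hr
    have : h =ᶠ[nhds r] fun _ => 0 := by
      filter_upwards [Ioi_mem_nhds hr] with s hs using hz s (le_of_lt hs)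
    rw [this.deriv_eq, deriv_const]
  have key := H (fun x => h ‖x‖) (contDiff_radial hh hε hc)
    (HasCompactSupport.intro (isCompact_closedBall 0 R) fun x hx => hz _ (by
      simpa using (not_le.1 (mem_closedBall_zero_iff.not.1 hx)).le))
  set A : ℝ → ℝ := fun r => -((m : ℝ) + 1) * (J2 r * J r ^ m)
  set B : ℝ → ℝ := fun r => -(J2 r * J r ^ m) + m * (1 - J1 r ^ 2) * J r ^ (m - 1)
  set F : ℝ → ℝ := fun r => J r ^ (m + 1) * deriv h r ^ 2 + lam * (min (A r) (B r) * h r ^ 2)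
  have hdens : AEMeasurable (fun x : E (m + 2) =>
      ENNReal.ofReal (Real.sqrt (rotMetric (m + 2) J x).det)) := by
    have hJc : Continuous fun x : E (m + 2) => J ‖x‖ :=
      hJ.continuousOn.comp_continuous continuous_norm fun x => norm_nonneg x
    have hm : Measurable fun x : E (m + 2) =>
        ENNReal.ofReal (J ‖x‖ ^ (m + 1) / ‖x‖ ^ (m + 1)) :=
      ((hJc.measurable.pow_const _).div (measurable_norm.pow_const _)).ennreal_ofReal
    refine hm.aemeasurable.congr ?_
    filter_upwards [hJ.ae_sqrt_det m] with x hx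
    rw [hx.2]
  have hint : ∫ x, (normSqDiff (rotMetric (m + 2) J) (fun x => h ‖x‖) x
      + lam * lowestRicci (rotMetric (m + 2) J) x * h ‖x‖ ^ 2) ∂(vol (rotMetric (m + 2) J))
      = polarConst m * ∫ r in Ioi (0 : ℝ), F r := by
    rw [vol, integral_withDensity_eq_integral_toReal_smul₀ hdens
      (ae_of_all _ fun x => ENNReal.ofReal_lt_top), ← integral_radial_div_pow]
    refine integral_congr_ae ?_
    filter_upwards [hJ.ae_sqrt_det m] with x hx
    have hr : 0 < ‖x‖ := by simpa using hx.1
    have hJr := hJ.pos _ hr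
    rw [ENNReal.toReal_ofReal (Real.sqrt_nonneg _), hx.2, smul_eq_mul,
      normSqDiff_radial hx.1 hJr (hdiff _),
      lowestRicci_rotMetric (by omega) hJ.hasDerivAt hJ.hasDerivAt_deriv hJ.pos hx.1]
    have hA : J ‖x‖ ^ (m + 1) * radialRicci (m + 2) J J2 ‖x‖ = A ‖x‖ := by
      simp only [radialRicci, A]
      push_cast
      field_simp
      ring
    have hB : J ‖x‖ ^ (m + 1) * tangentialRicci (m + 2) J J1 J2 ‖x‖ = B ‖x‖ := by
      simp only [tangentialRicci, B]
      rcases m with _ | m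
      · simp
        field_simp
      · push_cast
        field_simp
        ring
    have hmin : J ‖x‖ ^ (m + 1) * min (radialRicci (m + 2) J J2 ‖x‖)
        (tangentialRicci (m + 2) J J1 J2 ‖x‖) = min (A ‖x‖) (B ‖x‖) := by
      rw [mul_min_of_nonneg _ _ (by positivity), hA, hB]
    simp only [F]
    rw [← hmin]
    ring
  rw [hint] at key
  have hF0 := nonneg_of_mul_nonneg_right key (polarConst_pos m)
  have c0 := hJ.continuousOn
  have c1 := hJ.continuousOn_deriv
  have c2 := hJ.continuousOn_deriv2
  have c3 := hh.continuous.continuousOn (s := Ici 0)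
  have c4 := hd.continuousOn (s := Ici 0)
  rw [← hJ.integral_tangential m lam hR hdiff hd (hz R le_rfl)]
  have hIoc : ∫ r in Ioi (0 : ℝ), F r = ∫ r in 0..R, F r := by
    rw [intervalIntegral.integral_of_le hR.le]
    refine setIntegral_eq_of_subset_of_forall_sdiff_eq_zero measurableSet_Ioi
      (fun r hr => hr.1) fun r hr => ?_
    have hrR : R < r := by
      by_contra hle
      exact hr.2 ⟨hr.1, not_lt.1 hle⟩
    simp [F, hdz r hrR, hz r hrR.le]
  rw [hIoc] at hF0
  refine hF0.trans (intervalIntegral.integral_mono_on hR.le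
    (intervalIntegrable_of_continuousOn_Ici hR.le (by fun_prop))
    (intervalIntegrable_of_continuousOn_Ici hR.le (by fun_prop)) fun r hr => ?_)
  -- The lowest eigenvalue is bounded by the tangential one; the radial one is discarded.
  have := mul_le_mul_of_nonneg_right (min_le_right (A r) (B r)) (sq_nonneg (h r))
  exact add_le_add le_rfl (mul_le_mul_of_nonneg_left this hlam)

/-- The leading coefficient in M is (4λ - (m+1))/(m+1), positive precisely above the threshold on λ.
-/
lemma exists_exponent (m : ℕ) {lam : ℝ} (hlam : ((m : ℝ) + 1) / 4 < lam) :
    ∃ M : ℕ, 0 < 2 * lam * (M + 1) * (2 * M + 1) / (m + 1) - ((M : ℝ) + 1) ^ 2 := by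
  have hm : (0 : ℝ) < m + 1 := by positivity
  obtain ⟨M, hM⟩ := exists_nat_gt ((m + 1) / (4 * lam - (m + 1)))
  have hpos : 0 < 4 * lam - ((m : ℝ) + 1) := by linarith
  rw [div_lt_iff₀ hpos] at hM
  refine ⟨M, ?_⟩
  have e : 2 * lam * (M + 1) * (2 * M + 1) / (m + 1) - ((M : ℝ) + 1) ^ 2
      = (M + 1) * (M * (4 * lam - (m + 1)) + 2 * lam - (m + 1)) / (m + 1) := by
    field_simp
    ring
  rw [e]
  have : 0 < M * (4 * lam - (m + 1)) + 2 * lam - ((m : ℝ) + 1) := by linarith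
  positivity

end Volume
end RotSym

theorem mainTheorem6 (n : ℕ) (hn : 2 ≤ n) (lam : ℝ) (hlam : ((n : ℝ) - 1) / 4 < lam) :
    ∃ c : ℝ, 0 < c ∧ ∀ J : ℝ → ℝ,
      ContDiffOn ℝ ∞ J (Set.Ici 0) → J 0 = 0 → derivWithin J (Set.Ici 0) 0 = 1 →
      (∀ r : ℝ, 0 < r → 0 < J r) →
      RotSym.SchrodingerNonneg (RotSym.rotMetric n J)
        (fun x => lam * RotSym.lowestRicci (RotSym.rotMetric n J) x) →
      ∀ R : ℝ, 0 < R →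
        RotSym.vol (RotSym.rotMetric n J) (RotSym.geodBall (RotSym.rotMetric n J) 0 R)
          ≤ ENNReal.ofReal (c * R ^ n) := by
  obtain ⟨m, rfl⟩ : ∃ m, n = m + 2 := ⟨n - 2, by omega⟩
  have hlam' : ((m : ℝ) + 1) / 4 < lam := by
    refine lt_of_eq_of_lt ?_ hlam
    push_cast
    ring
  have hl0 : 0 < lam := lt_of_le_of_lt (by positivity) hlam'
  obtain ⟨M, hM⟩ := RotSym.exists_exponent m hlam'
  set κ : ℝ := 2 * lam * (M + 1) * (2 * M + 1) / (m + 1) - ((M : ℝ) + 1) ^ 2 with hκ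
  obtain ⟨δ, hδ, hκδ⟩ : ∃ δ : ℝ, 0 < δ ∧ lam * m * δ ^ 2 ≤ κ / 2 := by
    -- The denominator has m + 1 in place of m so that m = 0 needs no separate choice.
    refine ⟨Real.sqrt (κ / (2 * lam * (m + 1))), by positivity, ?_⟩
    rw [Real.sq_sqrt (by positivity)]
    have e : lam * m * (κ / (2 * lam * (m + 1))) = κ / 2 * (m / (m + 1)) := by field_simp
    rw [e]
    exact mul_le_of_le_one_right (by positivity) ((div_le_one (by positivity)).2 (by linarith))
  have hp := RotSym.polarConst_pos m
  refine ⟨RotSym.polarConst m * (4 ^ M * (2 / κ * (lam * m * δ⁻¹ ^ (m - 1) + lam))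
    * 2 ^ (m + 2)), by positivity, ?_⟩
  intro J hJs h0 h1 hpos H R hR
  have hJ := RotSym.isWarping_derivWithin hJs h0 h1 hpos
  refine (measure_mono (RotSym.geodBall_subset_ball J hR)).trans ?_
  rw [hJ.vol_ball m hR]
  apply ENNReal.ofReal_le_ofReal
  have hR2 : 0 < 2 * R := by positivity
  -- The test function lives on [0, 2R], and k is minus its derivative.
  have hE := hJ.radialEnergy_nonneg_of_smooth m hl0.le hR2
    (fun h hh hc hz => hJ.radial_nonneg m hl0.le H hR2 hh hc hz)
    (k := fun s => (M + 1) / (2 * R) * (1 - s / (2 * R)) ^ M) (by fun_prop)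
  simp only [RotSym.integral_one_sub_div_pow hR2] at hE
  have hW := hJ.weighted_estimate m hR2 M (lam := lam) (by simpa using hE)
  have hfin := hJ.integral_pow_le m hl0.le hR M hδ hκδ hM hW
  refine (mul_le_mul_of_nonneg_left hfin hp.le).trans (le_of_eq ?_)
  ring
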